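/- Let $m\ge 2$, $n=\lfloor m/2\rfloor$, $1\le m_0\le n$ and $p\in\mathbb Z_{\ge 0}$. Let $\mathcal M$ be the space of skew-symmetric $m\times m$ complex matrices, and let $\mathcal P_{m_0}$ be the ideal of its coordinate ring generated by the Pfaffians of all $2m_0\times 2m_0$ principal submatrices of the generic skew-symmetric matrix. For $l\in\mathbb Z_{\ge 0}\cup\{\infty\}$ let $\mathcal M_l$ be the space of $l$-jets of $\mathcal M$, i.e. of skew-symmetric $m\times m$ matrices over $R_l=\mathbb C[[t]]/(t^{l+1})$ ($R_\infty=\mathbb C[[t]]$, and $\infty$-jets are called arcs), with its Zariski topology: closed sets are the common zero sets of families of polynomials in the coefficients of the matrix entries. For $l\ge p$ let $\mathscr X_p^l\subset\mathcal M_l$ be the $p$-th contact locus: the set of $l$-jets along which $\mathcal P_{m_0}$ has order exactly $p$ in $t$. Put $$\Lambda_{n,l}=\{\lambda\in(\mathbb Z_{\ge 0}\cup\{\infty\})^n : \lambda_1\le\dots\le\lambda_n\le l+1\},\qquad \Lambda_{n,l}^{m_0,p}=\{\lambda\in\Lambda_{n,l} : \lambda_1+\dots+\lambda_{m_0}=p\}.$$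 For $\lambda\in\Lambda_{n,l}$ let $\mathcal C_{\lambda,l}\subset\mathcal M_l$ be the orbit, under the action $A\mapsto gAg^T$ of $\mathrm{GL}_m(R_l)$, of the block diagonal matrix with blocks $t^{\lambda_1}J,\dots,t^{\lambda_n}J$, followed by a zero row and column if $m$ is odd, where $J=\begin{pmatrix}0&1\\-1&0\end{pmatrix}$ and $t^\infty=0$. (1) For every $l\in\mathbb Z_{\ge p}\cup\{\infty\}$, $\mathscr X_p^l=\bigsqcup_{\lambda\in\Lambda_{n,l}^{m_0,p}}\mathcal C_{\lambda,l}$ (disjoint union). (2) For $\lambda,\lambda'\in\Lambda_{n,\infty}$, the closure of $\mathcal C_{\lambda,\infty}$ in $\mathcal M_\infty$ contains $\mathcal C_{\lambda',\infty}$ if and only if $\lambda_1+\dots+\lambda_k\le\lambda'_1+\dots+\lambda'_k$ for all $k=1,\dots,n$. (3) Let $\Lambda^{*}\subset\Lambda_{n,\infty}^{m_0,p}$ consist of the sequences for which there is an integer $k$ with $\lceil p/m_0\rceil\le k\le p$ if $m_0<n$, and $k=p$ if $m_0=n$, such that, with $d=\lfloor p/k\rfloor$ (and $d=0$ if $k=0$),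 $$\lambda_i=0\ \text{ for } i<m_0-d,\qquad \lambda_{m_0-d}=p-kd\ \text{ (if } m_0-d\ge 1),\qquad \lambda_i=k\ \text{ for } m_0-d<i\le n .$$ Then, closures being taken inside $\mathscr X_p^\infty$, $\mathscr X_p^\infty=\bigcup_{\lambda\in\Lambda^{*}}\overline{\mathcal C_{\lambda,\infty}}$ is the decomposition of $\mathscr X_p^\infty$ into irreducible components: the irreducible components are exactly the sets $\overline{\mathcal C_{\lambda,\infty}}$ with $\lambda\in\Lambda^{*}$, and distinct $\lambda\in\Lambda^*$ give distinct components. -/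

import Mathlib

/-!
Jets of skew-symmetric matrices, Pfaffian ideals, contact loci, congruence orbits.
The order `l` of a jet is an element of `ℕ∞`; an `∞`-jet is an arc.
-/

/-- The power `t ^ e` in `ℂ⟦t⟧`, with the convention `t ^ ∞ = 0`. -/
noncomputable def tPow : ℕ∞ → PowerSeries ℂ
  | ⊤ => 0
  | (n : ℕ) => PowerSeries.X ^ n

/-- The ideal `(t ^ (l + 1))` of `ℂ⟦t⟧`; it is zero for `l = ∞`. -/
noncomputable def jetIdeal (l : ℕ∞) : Ideal (PowerSeries ℂ) :=
  Ideal.span {tPow (l + 1)}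

/-- The ring `ℂ⟦t⟧ / (t ^ (l + 1))`; for `l = ∞` it is `ℂ⟦t⟧`. -/
abbrev JetRing (l : ℕ∞) : Type := PowerSeries ℂ ⧸ jetIdeal l

/-- The image of `t ^ e` in `ℂ⟦t⟧ / (t ^ (l + 1))`. -/
noncomputable def jetPow (l e : ℕ∞) : JetRing l :=
  Ideal.Quotient.mk (jetIdeal l) (tPow e)

theorem coeff_eq_zero_of_mem_jetIdeal {l : ℕ∞} {k : ℕ} (hk : (k : ℕ∞) ≤ l)
    {f : PowerSeries ℂ} (hf : f ∈ jetIdeal l) : PowerSeries.coeff k f = 0 := by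
  rw [jetIdeal, Ideal.mem_span_singleton] at hf
  induction l using ENat.recTopCoe with
  | top =>
    have h0 : tPow ((⊤ : ℕ∞) + 1) = 0 := rfl
    rw [h0, zero_dvd_iff] at hf
    simp [hf]
  | coe n =>
    have h0 : tPow ((n : ℕ∞) + 1) = PowerSeries.X ^ (n + 1) := rfl
    rw [h0, PowerSeries.X_pow_dvd_iff] at hf
    exact hf k (Nat.lt_succ_of_le (by exact_mod_cast hk))

/-- The coefficient of `t ^ k` of an element of `ℂ⟦t⟧ / (t ^ (l + 1))`, for `k ≤ l`. -/
noncomputable def jetCoeff (l : ℕ∞) (k : {k : ℕ // (k : ℕ∞) ≤ l}) (a : JetRing l) : ℂ :=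
  Quotient.liftOn' a (fun f => PowerSeries.coeff k.1 f) (by
    intro f g h
    have h' : f - g ∈ jetIdeal l := (Submodule.quotientRel_def _).mp h
    have h0 := coeff_eq_zero_of_mem_jetIdeal k.2 h'
    rw [map_sub] at h0
    exact sub_eq_zero.mp h0)

/-- The `l`-jets of the space of skew-symmetric `m × m` matrices: skew-symmetric matrices with
entries in `ℂ⟦t⟧ / (t ^ (l + 1))`. -/
def SkewJet (m : ℕ) (l : ℕ∞) : Type :=
  {A : Matrix (Fin m) (Fin m) (JetRing l) // A.transpose = -A}

/-- The coordinates of a jet: the coefficients of `t ^ k`, `k ≤ l`, of all its entries. -/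
noncomputable def SkewJet.coord {m : ℕ} {l : ℕ∞} (A : SkewJet m l) :
    Fin m × Fin m × {k : ℕ // (k : ℕ∞) ≤ l} → ℂ :=
  fun x => jetCoeff l x.2.2 (A.1 x.1 x.2.1)

/-- The set of jets at which all polynomials in `S` (in the coordinates of a jet) vanish. -/
def jetZeroLocus (m : ℕ) (l : ℕ∞)
    (S : Set (MvPolynomial (Fin m × Fin m × {k : ℕ // (k : ℕ∞) ≤ l}) ℂ)) :
    Set (SkewJet m l) :=
  {A | ∀ f ∈ S, MvPolynomial.eval A.coord f = 0}

/-- The Zariski topology on the space of `l`-jets (of arcs, if `l = ∞`): the closed sets are the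
common zero sets of families of polynomials in the coefficients of the entries. -/
instance SkewJet.zariskiTopology (m : ℕ) (l : ℕ∞) : TopologicalSpace (SkewJet m l) :=
  TopologicalSpace.ofClosed {Z | ∃ S, Z = jetZeroLocus m l S}
    ⟨{1}, by
      ext A
      simp [jetZeroLocus]⟩
    (by
      intro T hT
      refine ⟨{f | ∃ S, jetZeroLocus m l S ∈ T ∧ f ∈ S}, ?_⟩
      ext A
      constructor
      · rintro hA f ⟨S, hS, hf⟩
        exact hA _ hS f hf
      · intro hA Z hZ
        obtain ⟨S, rfl⟩ := hT hZ
        intro f hf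
        exact hA f ⟨S, hZ, hf⟩)
    (by
      rintro _ ⟨S, rfl⟩ _ ⟨T, rfl⟩
      refine ⟨{h | ∃ f ∈ S, ∃ g ∈ T, h = f * g}, ?_⟩
      ext A
      constructor
      · rintro (hA | hA) _ ⟨f, hf, g, hg, rfl⟩
        · simp [hA f hf]
        · simp [hA g hg]
      · intro hA
        by_contra hcon
        rw [Set.mem_union, not_or] at hcon
        obtain ⟨h1, h2⟩ := hcon
        simp only [jetZeroLocus, Set.mem_ofPred_eq, not_forall] at h1 h2
        obtain ⟨f, hf, hf0⟩ := h1
        obtain ⟨g, hg, hg0⟩ := h2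
        have h := hA (f * g) ⟨f, hf, g, hg, rfl⟩
        rw [map_mul] at h
        exact (mul_ne_zero hf0 hg0) h)

/-- The Pfaffian of a `2k × 2k` matrix,
`(1 / (2 ^ k k!)) ∑_σ sgn σ ∏_i A_{σ(2i-1), σ(2i)}`
(used for skew-symmetric matrices only). -/
noncomputable def pfaffian {R : Type*} [CommRing R] [Algebra ℂ R] (k : ℕ)
    (A : Matrix (Fin (2 * k)) (Fin (2 * k)) R) : R :=
  ((2 ^ k * (k.factorial : ℂ))⁻¹ : ℂ) •
    ∑ s : Equiv.Perm (Fin (2 * k)), (((Equiv.Perm.sign s : ℤˣ) : ℤ) : R) *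
      ∏ i : Fin k, A (s ⟨2 * i.1, by have := i.2; omega⟩) (s ⟨2 * i.1 + 1, by have := i.2; omega⟩)

/-- The coordinate ring `ℂ[x_ij] / (x_ij + x_ji)` of the space of skew-symmetric `m × m`
matrices. -/
abbrev SkewCoordRing (m : ℕ) : Type :=
  MvPolynomial (Fin m × Fin m) ℂ ⧸
    Ideal.span (Set.range fun x : Fin m × Fin m =>
      (MvPolynomial.X x + MvPolynomial.X x.swap : MvPolynomial (Fin m × Fin m) ℂ))

/-- The generic skew-symmetric `m × m` matrix. -/
noncomputable def genericSkew (m : ℕ) : Matrix (Fin m) (Fin m) (SkewCoordRing m) :=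
  fun i j => Ideal.Quotient.mk _ (MvPolynomial.X (i, j))

/-- The `k`-th Pfaffian ideal: it is generated by the Pfaffians of all `2k × 2k` principal
submatrices of the generic skew-symmetric matrix. -/
noncomputable def pfaffianIdeal (m k : ℕ) : Ideal (SkewCoordRing m) :=
  Ideal.span (Set.range fun r : Fin (2 * k) ↪o Fin m =>
    pfaffian k ((genericSkew m).submatrix r r))

/-- The comorphism of a jet: evaluation of regular functions at the jet. -/
noncomputable def SkewJet.comorphism {m : ℕ} {l : ℕ∞} (A : SkewJet m l) :
    SkewCoordRing m →ₐ[ℂ] JetRing l :=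
  Ideal.Quotient.liftₐ _ (MvPolynomial.aeval fun x : Fin m × Fin m => A.1 x.1 x.2) (by
    intro f hf
    have hle : Ideal.span (Set.range fun x : Fin m × Fin m =>
        (MvPolynomial.X x + MvPolynomial.X x.swap : MvPolynomial (Fin m × Fin m) ℂ)) ≤
        RingHom.ker (MvPolynomial.aeval (R := ℂ) fun x : Fin m × Fin m => A.1 x.1 x.2) := by
      rw [Ideal.span_le]
      rintro _ ⟨x, rfl⟩
      have h : A.1 x.2 x.1 = -A.1 x.1 x.2 := congrFun (congrFun A.2 x.1) x.2
      simp [RingHom.mem_ker, h]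
    exact hle hf)

/-- The `p`-th contact locus of the ideal `I` at the level of `l`-jets (for `p ≤ l`): the jets
along which `I` has order exactly `p` in `t`, that is, `I` pulls back into `(t ^ p)` but not into
`(t ^ (p + 1))`. -/
def contactLocus {m : ℕ} (I : Ideal (SkewCoordRing m)) (p : ℕ) (l : ℕ∞) : Set (SkewJet m l) :=
  {A | I.map A.comorphism ≤ Ideal.span {jetPow l (p : ℕ∞)} ∧
    ¬ I.map A.comorphism ≤ Ideal.span {jetPow l ((p + 1 : ℕ) : ℕ∞)}}

/-- The block diagonal matrix with the `2 × 2` blocks `t ^ (a q) * J`, `J = (0, 1; -1, 0)`,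
followed by a zero row and column if `m` is odd. -/
noncomputable def blockMatrix (m : ℕ) (l : ℕ∞) (a : Fin (m / 2) → ℕ∞) :
    Matrix (Fin m) (Fin m) (JetRing l) :=
  ∑ q : Fin (m / 2),
    (Matrix.single ⟨2 * q.1, by have := q.2; omega⟩ ⟨2 * q.1 + 1, by have := q.2; omega⟩
        (jetPow l (a q)) -
      Matrix.single ⟨2 * q.1 + 1, by have := q.2; omega⟩ ⟨2 * q.1, by have := q.2; omega⟩
        (jetPow l (a q)))

/-- The orbit of `blockMatrix m l a` under the congruence action `A ↦ g A gᵀ` of the group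
`GL_m(ℂ⟦t⟧ / (t ^ (l + 1)))`. -/
def congruenceOrbit (m : ℕ) (l : ℕ∞) (a : Fin (m / 2) → ℕ∞) : Set (SkewJet m l) :=
  {A | ∃ g : GL (Fin m) (JetRing l), A.1 = g.1 * blockMatrix m l a * g.1.transpose}

/-- The sum of the first `k` entries. -/
def partialSum {n : ℕ} (a : Fin n → ℕ∞) (k : ℕ) : ℕ∞ :=
  ∑ i ∈ Finset.univ.filter (fun i : Fin n => i.1 < k), a i

/-- Nondecreasing sequences of length `n` with values in `{0, 1, …, ∞}` bounded by `l + 1`. -/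
def LambdaSet (n : ℕ) (l : ℕ∞) : Set (Fin n → ℕ∞) :=
  {a | Monotone a ∧ ∀ i, a i ≤ l + 1}

/-- The sequences in `LambdaSet n l` whose first `m0` entries have sum `p`. -/
def LambdaContact (n m0 p : ℕ) (l : ℕ∞) : Set (Fin n → ℕ∞) :=
  {a | a ∈ LambdaSet n l ∧ partialSum a m0 = (p : ℕ∞)}

/-- The sequences `(0, …, 0, p - k ⌊p / k⌋, k, …, k)` in `LambdaContact n m0 p l`, the entries at
the (one-based) positions larger than `m0 - ⌊p / k⌋` being equal to `k`, where
`⌈p / m0⌉ ≤ k ≤ p` if `m0 < n`, and `k = p` if `m0 = n`. For `p = 0` this is the zero sequence. -/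
def LambdaStar (n m0 p : ℕ) (l : ℕ∞) : Set (Fin n → ℕ∞) :=
  {a | a ∈ LambdaContact n m0 p l ∧ ∃ k : ℕ, p ≤ m0 * k ∧ k ≤ p ∧ (m0 = n → k = p) ∧
    (∀ i : Fin n, m0 < i.1 + 1 + p / k → a i = (k : ℕ∞)) ∧
    (∀ i : Fin n, i.1 + 1 + p / k = m0 → a i = ((p - k * (p / k) : ℕ) : ℕ∞)) ∧
    (∀ i : Fin n, i.1 + 1 + p / k < m0 → a i = 0)}

/-!
Everything reduces to matrices over `ℂ⟦t⟧`: a skew-symmetric matrix over a jet ring has a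
skew-symmetric lift, and invertible matrices lift to invertible ones since `ℂ⟦t⟧` is local.

*Normal form and invariants.* Over `ℂ⟦t⟧` one splits off a hyperbolic plane at an entry of minimal
order, so that every skew-symmetric matrix is congruent to a block diagonal one with nondecreasing
exponents `a` (`exists_eq_mul_stdSkew_mul_transpose`). By the Cauchy–Binet formula for Pfaffians
(`dvd_pfaffian_mul_mul_transpose`) the least order of the `2 k × 2 k` principal Pfaffians is
invariant under congruence, and for the normal form it is the partial sum `a₁ + ⋯ + a_k`
(`pfaffianOrderGE_congr_iff`). This describes the contact locus as a union of orbits. Distinct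
orbits of jets are disjoint, because the lower bound for the Pfaffian orders persists under
perturbations by multiples of `t ^ (l + 1)` (`partialSum_le_of_mem_inter`).

*Closures.* The coefficients of a Pfaffian are polynomials in the coordinates of an arc, so partial
sums can only grow under specialization. Conversely, if the partial sums of `b` are at least those
of `a`, then `b` is reached from `a` by raising entries and by transferring units between two
entries (`dominance_induction`). Both moves are realized by families of matrices depending
polynomially on a parameter `s`, which stay in one orbit for `s ≠ 0`
(`congruenceOrbit_subset_closure_of_le`, `congruenceOrbit_subset_closure_of_transfer`). Hence the
closure order is the order of partial sums (`congruenceOrbit_subset_closure_iff`).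

*Components.* Orbits are irreducible, since `GL_m(ℂ⟦t⟧)` is dense on the line through any two of
its points. Among the nondecreasing sequences with `m0`-th partial sum `p` the minimal ones are
those in `LambdaStar`: fixing the entry `k` at the place `m0`, the partial sums are least when the
entries before that place are as unequal, and those after it as small, as possible; if there is no
later place, `k = p` is the best choice (`exists_mem_lambdaStar_le`). The partial sums at the places `m0 - 1` and `m0 + 1` show that
different `k` are incomparable (`eq_of_mem_lambdaStar`). A finite cover by irreducible closed sets
without inclusions is the decomposition into components (`irreducibleComponents_eq_image`).
-/

/-! ### Powers of `t` and divisibility of power series -/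

theorem tPow_dvd_iff {e : ℕ∞} {f : PowerSeries ℂ} :
    tPow e ∣ f ↔ ∀ k : ℕ, (k : ℕ∞) < e → PowerSeries.coeff k f = 0 := by
  induction e using ENat.recTopCoe with
  | top =>
    change (0 : PowerSeries ℂ) ∣ f ↔ _
    rw [zero_dvd_iff]
    constructor
    · rintro rfl k -
      simp
    · intro h
      ext k
      simpa using h k (ENat.natCast_lt_top k)
  | coe n =>
    change PowerSeries.X ^ n ∣ f ↔ _
    rw [PowerSeries.X_pow_dvd_iff]
    simp

theorem tPow_top : tPow ⊤ = 0 := rfl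

theorem tPow_coe (n : ℕ) : tPow n = PowerSeries.X ^ n := rfl

theorem tPow_zero : tPow 0 = 1 := by
  simpa using tPow_coe 0

theorem tPow_add (a b : ℕ∞) : tPow (a + b) = tPow a * tPow b := by
  induction a using ENat.recTopCoe with
  | top => simp [tPow_top]
  | coe a =>
    induction b using ENat.recTopCoe with
    | top => simp [tPow_top]
    | coe b => rw [← Nat.cast_add, tPow_coe, tPow_coe, tPow_coe, pow_add]

theorem tPow_sum {ι : Type*} (s : Finset ι) (a : ι → ℕ∞) :
    tPow (∑ i ∈ s, a i) = ∏ i ∈ s, tPow (a i) := by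
  classical
  induction s using Finset.induction_on with
  | empty => simp [tPow_zero]
  | insert i s hi ih => rw [Finset.sum_insert hi, Finset.prod_insert hi, tPow_add, ih]

theorem tPow_dvd_tPow_iff {a b : ℕ∞} : tPow a ∣ tPow b ↔ a ≤ b := by
  constructor
  · intro h
    rw [tPow_dvd_iff] at h
    by_contra! hlt
    lift b to ℕ using hlt.ne_top
    have := h b hlt
    simp [tPow_coe] at this
  · intro h
    obtain ⟨c, rfl⟩ := exists_add_of_le h
    rw [tPow_add]
    exact dvd_mul_right _ _

theorem mem_jetIdeal_iff {l : ℕ∞} {f : PowerSeries ℂ} : f ∈ jetIdeal l ↔ tPow (l + 1) ∣ f :=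
  Ideal.mem_span_singleton

theorem jetPow_dvd_mk_iff {l e : ℕ∞} (he : e ≤ l + 1) {f : PowerSeries ℂ} :
    jetPow l e ∣ Ideal.Quotient.mk (jetIdeal l) f ↔ tPow e ∣ f := by
  constructor
  · rintro ⟨y, hy⟩
    obtain ⟨y, rfl⟩ := Ideal.Quotient.mk_surjective y
    rw [jetPow, ← map_mul, Ideal.Quotient.eq, mem_jetIdeal_iff] at hy
    have h := (tPow_dvd_tPow_iff.2 he).trans hy
    exact (dvd_sub_left (dvd_mul_right _ _)).1 h
  · exact map_dvd _

/-! ### Pairs of consecutive indices -/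

/-- The zero-based index `2 q` in `Fin n`: the first index of the `q`-th pair. -/
def pairFst {k n : ℕ} (h : 2 * k ≤ n) (q : Fin k) : Fin n := ⟨2 * q.1, by omega⟩

/-- The zero-based index `2 q + 1` in `Fin n`: the second index of the `q`-th pair. -/
def pairSnd {k n : ℕ} (h : 2 * k ≤ n) (q : Fin k) : Fin n := ⟨2 * q.1 + 1, by omega⟩

section Pairs

variable {k n : ℕ} (h : 2 * k ≤ n)

@[simp] theorem pairFst_inj {p q : Fin k} : pairFst h p = pairFst h q ↔ p = q := by
  simp only [pairFst, Fin.ext_iff]; omega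

@[simp] theorem pairSnd_inj {p q : Fin k} : pairSnd h p = pairSnd h q ↔ p = q := by
  simp only [pairSnd, Fin.ext_iff]; omega

@[simp] theorem pairFst_ne_pairSnd {p q : Fin k} : pairFst h p ≠ pairSnd h q := by
  simp only [pairFst, pairSnd, ne_eq, Fin.ext_iff]; omega

@[simp] theorem pairSnd_ne_pairFst {p q : Fin k} : pairSnd h p ≠ pairFst h q :=
  (pairFst_ne_pairSnd h).symm

end Pairs

/-- The indices `0, …, 2 k - 1`, grouped into consecutive pairs. -/
def pairEquiv (k : ℕ) : Fin k × Fin 2 ≃ Fin (2 * k) :=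
  finProdFinEquiv.trans (finCongr (mul_comm k 2))

theorem pairEquiv_zero {k : ℕ} (q : Fin k) : pairEquiv k (q, 0) = pairFst le_rfl q := by
  ext; simp [pairEquiv, pairFst]

theorem pairEquiv_one {k : ℕ} (q : Fin k) : pairEquiv k (q, 1) = pairSnd le_rfl q := by
  ext; simp [pairEquiv, pairSnd, add_comm]

theorem prod_eq_prod_pairs {M : Type*} [CommMonoid M] {k : ℕ} (F : Fin (2 * k) → M) :
    ∏ j, F j = ∏ q : Fin k, F (pairFst le_rfl q) * F (pairSnd le_rfl q) := by
  rw [← (pairEquiv k).prod_comp, Fintype.prod_prod_type]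
  simp [Fin.prod_univ_two, pairEquiv_zero, pairEquiv_one]

theorem sum_eq_sum_pairs {M : Type*} [AddCommMonoid M] {k : ℕ} (F : Fin (2 * k) → M) :
    ∑ j, F j = ∑ q : Fin k, (F (pairFst le_rfl q) + F (pairSnd le_rfl q)) := by
  rw [← (pairEquiv k).sum_comp, Fintype.sum_prod_type]
  simp [Fin.sum_univ_two, pairEquiv_zero, pairEquiv_one]

/-- A function on `2 k` indices is a family of `k` pairs of values. -/
def pairArrowEquiv (k : ℕ) (X : Type*) : (Fin (2 * k) → X) ≃ (Fin k → X × X) :=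
  ((pairEquiv k).symm.arrowCongr (Equiv.refl X)).trans
    ((Equiv.curry _ _ _).trans ((Equiv.refl _).arrowCongr (finTwoArrowEquiv X)))

theorem pairArrowEquiv_apply {k : ℕ} {X : Type*} (f : Fin (2 * k) → X) (q : Fin k) :
    pairArrowEquiv k X f q = (f (pairFst le_rfl q), f (pairSnd le_rfl q)) := by
  simp [pairArrowEquiv, ← pairEquiv_zero, ← pairEquiv_one]

/-! ### Pfaffians -/

section Pfaffian

variable {R : Type*} [CommRing R] [Algebra ℂ R]

theorem pfaffian_eq (k : ℕ) (A : Matrix (Fin (2 * k)) (Fin (2 * k)) R) :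
    pfaffian k A = ((2 ^ k * (k.factorial : ℂ))⁻¹ : ℂ) •
      ∑ s : Equiv.Perm (Fin (2 * k)), (((Equiv.Perm.sign s : ℤˣ) : ℤ) : R) *
        ∏ i : Fin k, A (s (pairFst le_rfl i)) (s (pairSnd le_rfl i)) := rfl

theorem pfaffian_map {S : Type*} [CommRing S] [Algebra ℂ S] (φ : R →ₐ[ℂ] S) (k : ℕ)
    (A : Matrix (Fin (2 * k)) (Fin (2 * k)) R) : pfaffian k (A.map φ) = φ (pfaffian k A) := by
  simp [pfaffian_eq, map_smul, map_sum, map_mul, map_prod]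

/-- The Pfaffian is alternating under simultaneous permutations of rows and columns. -/
theorem pfaffian_submatrix_perm (k : ℕ) (A : Matrix (Fin (2 * k)) (Fin (2 * k)) R)
    (τ : Equiv.Perm (Fin (2 * k))) :
    pfaffian k (A.submatrix τ τ) = (((Equiv.Perm.sign τ : ℤˣ) : ℤ) : R) * pfaffian k A := by
  rw [pfaffian_eq, pfaffian_eq, mul_smul_comm]
  congr 1
  rw [Finset.mul_sum, ← Equiv.sum_comp (Equiv.mulLeft τ⁻¹)]
  refine Finset.sum_congr rfl fun s _ => ?_
  simp only [Equiv.coe_mulLeft, Matrix.submatrix_apply, Equiv.Perm.coe_mul, Function.comp_apply,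
    Equiv.Perm.sign_mul, Equiv.Perm.sign_inv]
  simp only [Equiv.Perm.inv_def, Equiv.apply_symm_apply]
  push_cast
  ring

/-- The expansion of the Pfaffian of `P * A * Pᵀ` into the minors of `P`. -/
theorem pfaffian_mul_mul_transpose {m : ℕ} (k : ℕ) (P : Matrix (Fin (2 * k)) (Fin m) R)
    (A : Matrix (Fin m) (Fin m) R) :
    pfaffian k (P * A * P.transpose) = ((2 ^ k * (k.factorial : ℂ))⁻¹ : ℂ) •
      ∑ f : Fin (2 * k) → Fin m, (∏ i : Fin k, A (f (pairFst le_rfl i)) (f (pairSnd le_rfl i))) *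
        (P.submatrix id f).det := by
  rw [pfaffian_eq]
  congr 1
  have hentry : ∀ x y, (P * A * P.transpose) x y =
      ∑ w : Fin m × Fin m, P x w.1 * A w.1 w.2 * P y w.2 := by
    intro x y
    rw [Fintype.sum_prod_type, Finset.sum_comm]
    simp only [Matrix.mul_apply, Matrix.transpose_apply, Finset.sum_mul]
  have hterm : ∀ s : Equiv.Perm (Fin (2 * k)),
      ∏ i : Fin k, (P * A * P.transpose) (s (pairFst le_rfl i)) (s (pairSnd le_rfl i)) =
      ∑ f : Fin (2 * k) → Fin m,
        (∏ i : Fin k, A (f (pairFst le_rfl i)) (f (pairSnd le_rfl i))) *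
          ∏ j, P (s j) (f j) := by
    intro s
    simp only [hentry]
    rw [Finset.prod_univ_sum, Fintype.piFinset_univ, ← (pairArrowEquiv k (Fin m)).sum_comp]
    refine Finset.sum_congr rfl fun f _ => ?_
    rw [prod_eq_prod_pairs, ← Finset.prod_mul_distrib]
    refine Finset.prod_congr rfl fun i _ => ?_
    rw [pairArrowEquiv_apply]
    ring
  simp only [hterm, Finset.mul_sum]
  rw [Finset.sum_comm]
  refine Finset.sum_congr rfl fun f _ => ?_
  rw [Matrix.det_apply', Finset.mul_sum]
  refine Finset.sum_congr rfl fun s _ => ?_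
  simp only [Matrix.submatrix_apply, id]
  ring

/-- A common divisor of the Pfaffians of the principal `2 k × 2 k` submatrices of `A` divides
the Pfaffian of `P * A * Pᵀ`. This is the divisibility content of the Cauchy–Binet formula for
Pfaffians; averaging over the permutations of the columns of `P`, which is possible over `ℂ`,
avoids a choice of representatives. -/
theorem dvd_pfaffian_mul_mul_transpose {m k : ℕ} {d : R} {A : Matrix (Fin m) (Fin m) R}
    (hd : ∀ r : Fin (2 * k) ↪o Fin m, d ∣ pfaffian k (A.submatrix r r))
    (P : Matrix (Fin (2 * k)) (Fin m) R) : d ∣ pfaffian k (P * A * P.transpose) := by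
  have hinj : ∀ f : Fin (2 * k) → Fin m, Function.Injective f →
      d ∣ pfaffian k (A.submatrix f f) := by
    intro f hf
    have hcard : (Finset.univ.image f).card = 2 * k := by
      rw [Finset.card_image_of_injective _ hf, Finset.card_univ, Fintype.card_fin]
    let r := (Finset.univ.image f).orderEmbOfFin hcard
    have hr : ∀ x, ∃ y, r y = f x := by
      intro x
      have : f x ∈ Set.range r := by simp [r]
      exact this
    choose τ hτ using hr
    have hτinj : Function.Injective τ := by
      intro x y hxy
      apply hf
      rw [← hτ, ← hτ, hxy]
    let e : Equiv.Perm (Fin (2 * k)) := Equiv.ofBijective τ hτinj.bijective_of_finite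
    have hfe : A.submatrix f f = (A.submatrix r r).submatrix e e := by
      ext x y
      simp [e, hτ]
    rw [hfe, pfaffian_submatrix_perm]
    exact (hd r).mul_left _
  set S : R := ∑ f : Fin (2 * k) → Fin m,
    (∏ i : Fin k, A (f (pairFst le_rfl i)) (f (pairSnd le_rfl i))) *
      (P.submatrix id f).det with hS
  have hperm : ∀ τ : Equiv.Perm (Fin (2 * k)), S = ∑ f : Fin (2 * k) → Fin m,
      (P.submatrix id f).det * ((((Equiv.Perm.sign τ : ℤˣ) : ℤ) : R) *
        ∏ i : Fin k, (A.submatrix f f) (τ (pairFst le_rfl i)) (τ (pairSnd le_rfl i))) := by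
    intro τ
    rw [hS, ← (τ.symm.arrowCongr (Equiv.refl (Fin m))).sum_comp]
    refine Finset.sum_congr rfl fun f _ => ?_
    have hdet : (P.submatrix id (f ∘ τ)).det =
        (((Equiv.Perm.sign τ : ℤˣ) : ℤ) : R) * (P.submatrix id f).det := by
      rw [← Matrix.det_permute' τ (P.submatrix id f)]
      rfl
    have hf : (τ.symm.arrowCongr (Equiv.refl (Fin m))) f = f ∘ τ := by
      ext x; simp [Equiv.arrowCongr]
    rw [hf, hdet]
    simp only [Function.comp_apply, Matrix.submatrix_apply]
    ring
  have hpf : ∀ f : Fin (2 * k) → Fin m,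
      ∑ τ : Equiv.Perm (Fin (2 * k)), (((Equiv.Perm.sign τ : ℤˣ) : ℤ) : R) *
        ∏ i : Fin k, (A.submatrix f f) (τ (pairFst le_rfl i)) (τ (pairSnd le_rfl i)) =
      (2 ^ k * (k.factorial : ℂ)) • pfaffian k (A.submatrix f f) := by
    intro f
    have hne : (2 ^ k * (k.factorial : ℂ)) ≠ 0 :=
      mul_ne_zero (by simp) (by exact_mod_cast k.factorial_ne_zero)
    rw [pfaffian_eq, smul_smul, mul_inv_cancel₀ hne, one_smul]
  have hsum : (((2 * k).factorial : ℂ)) • S = ∑ f : Fin (2 * k) → Fin m,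
      (P.submatrix id f).det * ((2 ^ k * (k.factorial : ℂ)) • pfaffian k (A.submatrix f f)) := by
    have h1 : ∑ _τ : Equiv.Perm (Fin (2 * k)), S = (((2 * k).factorial : ℂ)) • S := by
      rw [Finset.sum_const, Finset.card_univ, Fintype.card_perm, Fintype.card_fin,
        Nat.cast_smul_eq_nsmul]
    rw [← h1, Finset.sum_congr rfl fun τ _ => hperm τ, Finset.sum_comm]
    refine Finset.sum_congr rfl fun f _ => ?_
    rw [← Finset.mul_sum, hpf]
  have hdS : d ∣ (((2 * k).factorial : ℂ)) • S := by
    rw [hsum]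
    refine Finset.dvd_sum fun f _ => ?_
    by_cases hf : Function.Injective f
    · exact (dvd_smul_of_dvd _ (hinj f hf)).mul_left _
    · obtain ⟨x, y, hxy, hne⟩ : ∃ x y, f x = f y ∧ x ≠ y := by
        simpa [Function.Injective] using hf
      rw [Matrix.det_zero_of_column_eq hne (fun z => by simp [hxy]), zero_mul]
      exact dvd_zero _
  have hS' : S = (((2 * k).factorial : ℂ))⁻¹ • ((((2 * k).factorial : ℂ)) • S) := by
    rw [smul_smul, inv_mul_cancel₀ (by exact_mod_cast (2 * k).factorial_ne_zero), one_smul]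
  rw [pfaffian_mul_mul_transpose, ← hS, hS']
  exact dvd_smul_of_dvd _ (dvd_smul_of_dvd _ hdS)

end Pfaffian

/-! ### Pfaffians of block diagonal matrices -/

section Blocks

variable {R : Type*} [CommRing R]

/-- The block diagonal matrix with the `2 × 2` blocks `c q * J`, `J = (0, 1; -1, 0)`, over an
arbitrary commutative ring. -/
def stdSkew (m : ℕ) (c : Fin (m / 2) → R) : Matrix (Fin m) (Fin m) R :=
  ∑ q : Fin (m / 2),
    (Matrix.single (pairFst (Nat.mul_div_le m 2) q) (pairSnd (Nat.mul_div_le m 2) q) (c q) -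
      Matrix.single (pairSnd (Nat.mul_div_le m 2) q) (pairFst (Nat.mul_div_le m 2) q) (c q))

theorem stdSkew_map {S : Type*} [CommRing S] (φ : R →+* S) (m : ℕ) (c : Fin (m / 2) → R) :
    (stdSkew m c).map φ = stdSkew m (φ ∘ c) := by
  ext i j
  simp only [stdSkew, Matrix.map_apply, Matrix.sum_apply, Matrix.sub_apply, map_sum, map_sub,
    Matrix.single_apply, Function.comp_apply, apply_ite φ, map_zero]

theorem blockMatrix_eq (m : ℕ) (l : ℕ∞) (a : Fin (m / 2) → ℕ∞) :
    blockMatrix m l a = stdSkew m (fun q => jetPow l (a q)) := rfl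

theorem stdSkew_transpose (m : ℕ) (c : Fin (m / 2) → R) :
    (stdSkew m c).transpose = -stdSkew m c := by
  simp [stdSkew, Matrix.transpose_sum, Matrix.transpose_sub]

theorem mul_stdSkew_mul_transpose_apply {m : ℕ} (g : Matrix (Fin m) (Fin m) R)
    (c : Fin (m / 2) → R) (i j : Fin m) :
    (g * stdSkew m c * g.transpose) i j = ∑ q : Fin (m / 2), c q *
      (g i (pairFst (Nat.mul_div_le m 2) q) * g j (pairSnd (Nat.mul_div_le m 2) q) -
        g i (pairSnd (Nat.mul_div_le m 2) q) * g j (pairFst (Nat.mul_div_le m 2) q)) := by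
  simp only [stdSkew, Finset.mul_sum, Finset.sum_mul, Matrix.sum_apply]
  refine Finset.sum_congr rfl fun q _ => ?_
  have hs : ∀ u v : Fin m, (g * Matrix.single u v (c q) * g.transpose) i j =
      c q * (g i u * g j v) := by
    intro u v
    rw [Matrix.mul_assoc, Matrix.mul_apply,
      Finset.sum_eq_single u (fun x _ hx => by
        rw [Matrix.single_mul_apply_of_ne _ _ _ _ _ hx, mul_zero]) (by simp),
      Matrix.single_mul_apply_same, Matrix.transpose_apply]
    ring
  rw [Matrix.mul_sub, Matrix.sub_mul, Matrix.sub_apply, hs, hs]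
  ring

/-- In the Pfaffian of a block diagonal matrix with `2 × 2` skew-symmetric blocks all nonzero
terms are equal: they come from the permutations that permute the blocks and then
permute each block, and such a permutation has the sign of its part inside the blocks. -/
theorem pfaffian_blocks [Algebra ℂ R] {k : ℕ} {B : Matrix (Fin (2 * k)) (Fin (2 * k)) R}
    {c : Fin k → R}
    (h00 : ∀ p q, B (pairFst le_rfl p) (pairFst le_rfl q) = 0)
    (h11 : ∀ p q, B (pairSnd le_rfl p) (pairSnd le_rfl q) = 0)
    (h01 : ∀ p q, B (pairFst le_rfl p) (pairSnd le_rfl q) = if p = q then c p else 0)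
    (h10 : ∀ p q, B (pairSnd le_rfl p) (pairFst le_rfl q) = if p = q then -c p else 0) :
    ∃ z : ℂ, z ≠ 0 ∧ pfaffian k B = z • ∏ i, c i := by
  classical
  let e := pairEquiv k
  -- the permutations that respect the partition into pairs
  let Q : Equiv.Perm (Fin (2 * k)) → Prop := fun s =>
    ∀ i, (e.symm (s (pairFst le_rfl i))).1 = (e.symm (s (pairSnd le_rfl i))).1
  have hB : ∀ x y : Fin (2 * k), (e.symm x).1 ≠ (e.symm y).1 → B x y = 0 := by
    intro x y
    obtain ⟨⟨i, b⟩, rfl⟩ := e.surjective x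
    obtain ⟨⟨j, b'⟩, rfl⟩ := e.surjective y
    simp only [Equiv.symm_apply_apply]
    intro hij
    fin_cases b <;> fin_cases b' <;>
      simp [e, pairEquiv_zero, pairEquiv_one, h00, h11, h01, h10, hij]
  have hterm : ∀ s : Equiv.Perm (Fin (2 * k)), (((Equiv.Perm.sign s : ℤˣ) : ℤ) : R) *
      ∏ i : Fin k, B (s (pairFst le_rfl i)) (s (pairSnd le_rfl i)) =
      if Q s then ∏ i, c i else 0 := by
    intro s
    split_ifs with hs
    · let s' : Equiv.Perm (Fin k × Fin 2) := (e.trans s).trans e.symm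
      have hsign : Equiv.Perm.sign s = Equiv.Perm.sign s' :=
        (Equiv.Perm.sign_symm_trans_trans s e.symm).symm
      have hs' : ∀ i, (s' (i, 0)).1 = (s' (i, 1)).1 := by
        intro i
        have := hs i
        rw [← pairEquiv_zero, ← pairEquiv_one] at this
        exact this
      have hsnd : ∀ i, (s' (i, 0)).2 ≠ (s' (i, 1)).2 := by
        intro i h
        have := s'.injective (Prod.ext (hs' i) h)
        simp at this
      let π : Fin k → Fin k := fun i => (s' (i, 0)).1
      have hπ : Function.Injective π := by
        intro i j hij
        have hcase : (s' (j, 0)).2 = (s' (i, 0)).2 ∨ (s' (j, 0)).2 = (s' (i, 1)).2 := by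
          have := hsnd i
          omega
        rcases hcase with h | h
        · have := s'.injective (Prod.ext (show (s' (j, 0)).1 = (s' (i, 0)).1 from hij.symm) h)
          simpa using (congrArg Prod.fst this).symm
        · have := s'.injective
            (Prod.ext (show (s' (j, 0)).1 = (s' (i, 1)).1 from hij.symm.trans (hs' i)) h)
          simpa using (congrArg Prod.fst this).symm
      let π' : Equiv.Perm (Fin k) := Equiv.ofBijective π hπ.bijective_of_finite
      let ε : Fin k → Equiv.Perm (Fin 2) := fun i =>
        if (s' (i, 0)).2 = 0 then 1 else Equiv.swap 0 1
      have hdec : s' = (Equiv.prodCongrRight ε).trans (Equiv.prodCongrLeft fun _ => π') := by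
        ext1 ⟨i, b⟩
        have h2 := hsnd i
        refine Prod.ext ?_ ?_
        · fin_cases b
          · rfl
          · exact (hs' i).symm
        · change (s' (i, b)).2 = ε i b
          simp only [ε]
          fin_cases b <;> simp only [Fin.zero_eta, Fin.mk_one] <;> split_ifs with h0
          · simpa using h0
          · simp; omega
          · simp; omega
          · simp; omega
      have hsign' : Equiv.Perm.sign s = ∏ i, Equiv.Perm.sign (ε i) := by
        rw [hsign, hdec, Equiv.Perm.sign_trans, Equiv.Perm.sign_prodCongrRight,
          Equiv.Perm.sign_prodCongrLeft]
        simp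
      have hval : ∀ i, B (s (pairFst le_rfl i)) (s (pairSnd le_rfl i)) =
          (((Equiv.Perm.sign (ε i) : ℤˣ) : ℤ) : R) * c (π' i) := by
        intro i
        have e0 : s (pairFst le_rfl i) = e (π' i, ε i 0) := by
          rw [← pairEquiv_zero, ← e.symm_apply_eq]
          change s' (i, 0) = _
          rw [hdec]; rfl
        have e1 : s (pairSnd le_rfl i) = e (π' i, ε i 1) := by
          rw [← pairEquiv_one, ← e.symm_apply_eq]
          change s' (i, 1) = _
          rw [hdec]; rfl
        rw [e0, e1]
        simp only [ε]
        split_ifs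
        · simp [e, pairEquiv_zero, pairEquiv_one, h01]
        · simp [e, pairEquiv_zero, pairEquiv_one, h10]
      rw [hsign', Finset.prod_congr rfl fun i _ => hval i, Finset.prod_mul_distrib,
        Equiv.prod_comp π' c, ← mul_assoc]
      push_cast
      rw [← Finset.prod_mul_distrib, Finset.prod_eq_one, one_mul]
      intro i _
      rcases Int.units_eq_one_or (Equiv.Perm.sign (ε i)) with h | h <;> simp [h]
    · obtain ⟨i, hi⟩ : ∃ i, ¬ (e.symm (s (pairFst le_rfl i))).1 =
          (e.symm (s (pairSnd le_rfl i))).1 := by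
        simpa [Q] using hs
      rw [Finset.prod_eq_zero (Finset.mem_univ i) (hB _ _ hi), mul_zero]
  refine ⟨(2 ^ k * (k.factorial : ℂ))⁻¹ * ((Finset.univ.filter Q).card : ℂ), ?_, ?_⟩
  · refine mul_ne_zero (inv_ne_zero (mul_ne_zero (by simp) ?_)) ?_
    · exact_mod_cast k.factorial_ne_zero
    · have hpos : 0 < (Finset.univ.filter Q).card := by
        refine Finset.card_pos.2 ⟨1, Finset.mem_filter.2 ⟨Finset.mem_univ _, fun i => ?_⟩⟩
        simp [e, ← pairEquiv_zero, ← pairEquiv_one]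
      exact_mod_cast hpos.ne'
  · rw [pfaffian_eq, mul_smul]
    congr 1
    rw [Finset.sum_congr rfl fun s _ => hterm s, ← Finset.sum_filter, Finset.sum_const,
      Nat.cast_smul_eq_nsmul]

end Blocks

/-! ### Partial sums -/

theorem partialSum_eq_sum {n k : ℕ} (a : Fin n → ℕ∞) (hk : k ≤ n) :
    partialSum a k = ∑ i : Fin k, a (Fin.castLE hk i) := by
  rw [partialSum]
  symm
  refine Finset.sum_bij (fun i _ => Fin.castLE hk i) ?_ ?_ ?_ ?_
  · intro i _; simp
  · intro i _ j _ h; simpa using h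
  · intro i hi
    exact ⟨⟨i.1, by simpa using hi⟩, Finset.mem_univ _, rfl⟩
  · intro i _; rfl

theorem partialSum_zero {n : ℕ} (a : Fin n → ℕ∞) : partialSum a 0 = 0 := by
  simp [partialSum]

theorem partialSum_succ {n k : ℕ} (a : Fin n → ℕ∞) (hk : k < n) :
    partialSum a (k + 1) = partialSum a k + a ⟨k, hk⟩ := by
  rw [partialSum_eq_sum a hk, partialSum_eq_sum a hk.le, Fin.sum_univ_castSucc]
  rfl

/-- Nondecreasing sequences are determined by their partial sums, even in the presence of
infinite entries. -/
theorem eq_of_partialSum_eq {n : ℕ} {a b : Fin n → ℕ∞} (ha : Monotone a) (hb : Monotone b)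
    (h : ∀ k ≤ n, partialSum a k = partialSum b k) : a = b := by
  have key : ∀ k (hk : k < n), a ⟨k, hk⟩ = b ⟨k, hk⟩ := by
    intro k
    induction k using Nat.strong_induction_on with
    | _ k ih =>
      intro hk
      have h1 := h (k + 1) hk
      rw [partialSum_succ a hk, partialSum_succ b hk, ← h k hk.le] at h1
      by_cases htop : partialSum a k = ⊤
      · rw [partialSum_eq_sum a hk.le, ENat.sum_eq_top] at htop
        obtain ⟨i, -, hi⟩ := htop
        have hik : Fin.castLE hk.le i ≤ ⟨k, hk⟩ := i.2.le
        have hai : a ⟨k, hk⟩ = ⊤ := top_le_iff.1 (hi.ge.trans (ha hik))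
        have hbi : b (Fin.castLE hk.le i) = ⊤ := (ih i.1 i.2 (i.2.trans hk)).symm.trans hi
        rw [hai, top_le_iff.1 (hbi.ge.trans (hb hik))]
      · exact ENat.add_right_injective_of_ne_top htop h1
  ext i
  rw [key i.1 i.2]

/-! ### The order of the Pfaffian ideals of a matrix of power series -/

/-- The Pfaffians of all `2 k × 2 k` principal submatrices of `A` have order at least `e`. -/
def PfaffianOrderGE {m : ℕ} (k : ℕ) (A : Matrix (Fin m) (Fin m) (PowerSeries ℂ)) (e : ℕ∞) : Prop :=
  ∀ r : Fin (2 * k) ↪o Fin m, tPow e ∣ pfaffian k (A.submatrix r r)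

theorem PfaffianOrderGE.mul_mul_transpose {m k : ℕ} {A : Matrix (Fin m) (Fin m) (PowerSeries ℂ)}
    {e : ℕ∞} (h : PfaffianOrderGE k A e) (g : Matrix (Fin m) (Fin m) (PowerSeries ℂ)) :
    PfaffianOrderGE k (g * A * g.transpose) e := by
  intro r
  have hr : (g * A * g.transpose).submatrix r r =
      (g.submatrix r id) * A * (g.submatrix r id).transpose := by
    ext i j
    simp [Matrix.mul_apply]
  rw [hr]
  exact dvd_pfaffian_mul_mul_transpose h _

theorem le_of_add_self_le_add_self {x y : ℕ∞} (h : x + x ≤ y + y) : x ≤ y :=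
  not_lt.1 fun hlt => h.not_gt (ENat.add_lt_add hlt hlt)

theorem le_apply_of_orderEmbedding {j m : ℕ} (r : Fin j ↪o Fin m) (i : Fin j) :
    i.1 ≤ (r i).1 := by
  obtain ⟨i, hi⟩ := i
  induction i with
  | zero => exact Nat.zero_le _
  | succ i ih =>
    have h1 := ih (by omega)
    have h2 : r ⟨i, by omega⟩ < r ⟨i + 1, hi⟩ := r.strictMono (by simp [Fin.lt_def])
    have h3 := Fin.lt_def.1 h2
    simp only at h1 ⊢
    omega

/-- If the entries of `A` are divisible by `t ^ max (w i) (w j)` for nondecreasing weights `w`,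
then each term of a `2 k × 2 k` Pfaffian has order at least half of the sum of the first `2 k`
weights. -/
theorem pfaffianOrderGE_of_weights {m k : ℕ} {w : Fin m → ℕ∞} (hw : Monotone w)
    {A : Matrix (Fin m) (Fin m) (PowerSeries ℂ)}
    (hA : ∀ u v, tPow (max (w u) (w v)) ∣ A u v) {e : ℕ∞}
    (he : ∀ h : 2 * k ≤ m, e + e ≤ ∑ j : Fin (2 * k), w (Fin.castLE h j)) :
    PfaffianOrderGE k A e := by
  intro r
  have hkm : 2 * k ≤ m := by simpa using Fintype.card_le_of_embedding r.toEmbedding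
  rw [pfaffian_eq]
  refine dvd_smul_of_dvd _ (Finset.dvd_sum fun s _ => Dvd.dvd.mul_left ?_ _)
  refine dvd_trans ?_ (Finset.prod_dvd_prod_of_dvd _ _ fun i _ => hA _ _)
  rw [← tPow_sum, tPow_dvd_tPow_iff]
  refine le_of_add_self_le_add_self ((he hkm).trans ?_)
  calc ∑ j : Fin (2 * k), w (Fin.castLE hkm j) ≤ ∑ j : Fin (2 * k), w (r j) :=
        Finset.sum_le_sum fun j _ => hw (le_apply_of_orderEmbedding r j)
    _ = ∑ j : Fin (2 * k), w (r (s j)) := (Equiv.sum_comp s fun j => w (r j)).symm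
    _ = ∑ i : Fin k, (w (r (s (pairFst le_rfl i))) + w (r (s (pairSnd le_rfl i)))) :=
        sum_eq_sum_pairs _
    _ ≤ _ := by
        rw [← Finset.sum_add_distrib]
        exact Finset.sum_le_sum fun i _ => add_le_add (le_max_left _ _) (le_max_right _ _)

/-- The weight of a row of `blockMatrix m l b`; the zero row, if there is one, has weight
`l + 1`. -/
def rowWeight (m : ℕ) (l : ℕ∞) (b : Fin (m / 2) → ℕ∞) (u : Fin m) : ℕ∞ :=
  if h : u.1 / 2 < m / 2 then b ⟨u.1 / 2, h⟩ else l + 1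

theorem rowWeight_pairFst {m : ℕ} (l : ℕ∞) (b : Fin (m / 2) → ℕ∞) (q : Fin (m / 2)) :
    rowWeight m l b (pairFst (Nat.mul_div_le m 2) q) = b q := by
  simp [rowWeight, pairFst]

theorem rowWeight_pairSnd {m : ℕ} (l : ℕ∞) (b : Fin (m / 2) → ℕ∞) (q : Fin (m / 2)) :
    rowWeight m l b (pairSnd (Nat.mul_div_le m 2) q) = b q := by
  have h : (2 * q.1 + 1) / 2 = q.1 := by omega
  simp [rowWeight, pairSnd, h]

/-- The Pfaffian orders of a block diagonal matrix do not drop under a perturbation by a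
multiple of `t ^ (l + 1)`. -/
theorem pfaffianOrderGE_stdSkew_add {m k : ℕ} {l : ℕ∞} {b : Fin (m / 2) → ℕ∞}
    (hb : b ∈ LambdaSet (m / 2) l) (S : Matrix (Fin m) (Fin m) (PowerSeries ℂ)) :
    PfaffianOrderGE k (stdSkew m (fun q => tPow (b q)) + tPow (l + 1) • S) (partialSum b k) := by
  have hle : ∀ u, rowWeight m l b u ≤ l + 1 := by
    intro u
    rw [rowWeight]
    split_ifs
    exacts [hb.2 _, le_rfl]
  refine pfaffianOrderGE_of_weights (w := rowWeight m l b) ?_ ?_ ?_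
  · intro u v huv
    have huv' : u.1 / 2 ≤ v.1 / 2 := Nat.div_le_div_right huv
    by_cases hv : v.1 / 2 < m / 2
    · simp only [rowWeight, hv, huv'.trans_lt hv, dif_pos]
      exact hb.1 huv'
    · simpa [rowWeight, hv] using hle u
  · intro u v
    refine dvd_add ?_ ((tPow_dvd_tPow_iff.2 (max_le (hle u) (hle v))).mul_right _)
    rw [stdSkew, Matrix.sum_apply]
    refine Finset.dvd_sum fun q _ => ?_
    rw [Matrix.sub_apply, Matrix.single_apply, Matrix.single_apply]
    refine dvd_sub ?_ ?_
    · split_ifs with h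
      · rw [← h.1, ← h.2, rowWeight_pairFst, rowWeight_pairSnd, max_self]
      · exact dvd_zero _
    · split_ifs with h
      · rw [← h.1, ← h.2, rowWeight_pairFst, rowWeight_pairSnd, max_self]
      · exact dvd_zero _
  · intro h
    have hk : k ≤ m / 2 := by omega
    rw [sum_eq_sum_pairs, partialSum_eq_sum b hk, ← Finset.sum_add_distrib]
    refine Finset.sum_le_sum fun i _ => ?_
    have h0 : Fin.castLE h (pairFst le_rfl i) =
      pairFst (Nat.mul_div_le m 2) (Fin.castLE hk i) := rfl
    have h1 : Fin.castLE h (pairSnd le_rfl i) =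
      pairSnd (Nat.mul_div_le m 2) (Fin.castLE hk i) := rfl
    rw [h0, h1, rowWeight_pairFst, rowWeight_pairSnd]

theorem le_partialSum_of_pfaffianOrderGE_stdSkew {m k : ℕ} {b : Fin (m / 2) → ℕ∞}
    (hk : k ≤ m / 2) {e : ℕ∞}
    (h : PfaffianOrderGE k (stdSkew m (fun q => tPow (b q))) e) : e ≤ partialSum b k := by
  have hkm : 2 * k ≤ m := by omega
  have hr := h (Fin.castLEOrderEmb hkm)
  have hentry : ∀ u v : Fin m, stdSkew m (fun q => tPow (b q)) u v =
      ∑ q, ((if pairFst (Nat.mul_div_le m 2) q = u ∧ pairSnd (Nat.mul_div_le m 2) q = v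
        then tPow (b q) else 0) -
      if pairSnd (Nat.mul_div_le m 2) q = u ∧ pairFst (Nat.mul_div_le m 2) q = v
        then tPow (b q) else 0) := by
    intro u v
    simp only [stdSkew, Matrix.sum_apply, Matrix.sub_apply, Matrix.single_apply]
  have h0 : ∀ i : Fin k, Fin.castLEOrderEmb hkm (pairFst le_rfl i) =
      pairFst (Nat.mul_div_le m 2) (Fin.castLE hk i) := fun _ => rfl
  have h1 : ∀ i : Fin k, Fin.castLEOrderEmb hkm (pairSnd le_rfl i) =
      pairSnd (Nat.mul_div_le m 2) (Fin.castLE hk i) := fun _ => rfl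
  obtain ⟨z, hz, hpf⟩ := pfaffian_blocks
    (B := (stdSkew m (fun q => tPow (b q))).submatrix (Fin.castLEOrderEmb hkm)
      (Fin.castLEOrderEmb hkm)) (c := fun i => tPow (b (Fin.castLE hk i)))
    (by intro p q; simp [hentry, h0])
    (by intro p q; simp [hentry, h1])
    (by
      intro p q
      simp only [Matrix.submatrix_apply, hentry, h0, h1, pairFst_inj, pairSnd_inj]
      by_cases hpq : p = q
      · subst hpq; simp
      · rw [if_neg hpq]
        refine Finset.sum_eq_zero fun x _ => ?_
        rw [if_neg, if_neg] <;> simp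
        rintro rfl
        simpa using hpq)
    (by
      intro p q
      simp only [Matrix.submatrix_apply, hentry, h0, h1, pairFst_inj, pairSnd_inj]
      by_cases hpq : p = q
      · subst hpq; simp
      · rw [if_neg hpq]
        refine Finset.sum_eq_zero fun x _ => ?_
        rw [if_neg, if_neg] <;> simp
        rintro rfl
        simpa using hpq)
  rw [hpf, ← tPow_sum, ← partialSum_eq_sum] at hr
  rw [← tPow_dvd_tPow_iff]
  have := dvd_smul_of_dvd z⁻¹ hr
  rwa [smul_smul, inv_mul_cancel₀ hz, one_smul] at this

/-! ### Normal forms of skew-symmetric matrices of power series -/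

theorem stdSkew_apply {R : Type*} [CommRing R] {m : ℕ} (c : ℕ → R) (u v : Fin m) :
    stdSkew m (fun q => c q.1) u v =
      if u.1 % 2 = 0 ∧ v.1 = u.1 + 1 then c (u.1 / 2)
      else if v.1 % 2 = 0 ∧ u.1 = v.1 + 1 then -c (v.1 / 2) else 0 := by
  simp only [stdSkew, Matrix.sum_apply, Matrix.sub_apply, Matrix.single_apply, pairFst, pairSnd,
    Fin.ext_iff]
  have hu := u.2
  have hv := v.2
  split_ifs with h1 h2
  · rw [Finset.sum_eq_single ⟨u.1 / 2, by omega⟩]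
    · rw [if_pos (by dsimp only; omega), if_neg (by dsimp only; omega), sub_zero]
    · intro q _ hq
      have hq' : q.1 ≠ u.1 / 2 := fun h => hq (Fin.ext h)
      rw [if_neg (by omega), if_neg (by omega), sub_zero]
    · simp
  · rw [Finset.sum_eq_single ⟨v.1 / 2, by omega⟩]
    · rw [if_neg (by dsimp only; omega), if_pos (by dsimp only; omega), zero_sub]
    · intro q _ hq
      have hq' : q.1 ≠ v.1 / 2 := fun h => hq (Fin.ext h)
      rw [if_neg (by omega), if_neg (by omega), sub_zero]
    · simp
  · refine Finset.sum_eq_zero fun q _ => ?_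
    rw [if_neg (by omega), if_neg (by omega), sub_zero]

/-- Splitting off the first block of a block diagonal matrix. -/
theorem stdSkew_submatrix_finSumFinEquiv {R : Type*} [CommRing R] {m : ℕ} (c : ℕ → R) :
    (stdSkew (2 + m) (fun q => c q.1)).submatrix finSumFinEquiv finSumFinEquiv =
      Matrix.fromBlocks !![0, c 0; -c 0, 0] 0 0 (stdSkew m (fun q => c (q.1 + 1))) := by
  ext i j
  rw [Matrix.submatrix_apply, stdSkew_apply]
  rcases i with i | i <;> rcases j with j | j
  · fin_cases i <;> fin_cases j <;> simp
  · have hi := i.2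
    have e1 : (finSumFinEquiv (Sum.inl i : Fin 2 ⊕ Fin m)).1 = i.1 := rfl
    have e2 : (finSumFinEquiv (Sum.inr j : Fin 2 ⊕ Fin m)).1 = 2 + j.1 := rfl
    rw [if_neg (by omega), if_neg (by omega)]
    rfl
  · have hj := j.2
    have e1 : (finSumFinEquiv (Sum.inl j : Fin 2 ⊕ Fin m)).1 = j.1 := rfl
    have e2 : (finSumFinEquiv (Sum.inr i : Fin 2 ⊕ Fin m)).1 = 2 + i.1 := rfl
    rw [if_neg (by omega), if_neg (by omega)]
    rfl
  · rw [Matrix.fromBlocks_apply₂₂, stdSkew_apply (fun q => c (q + 1))]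
    simp only [finSumFinEquiv_apply_right, Fin.val_natAdd]
    have e1 : (2 + i.1) / 2 = i.1 / 2 + 1 := by omega
    have e2 : (2 + j.1) / 2 = j.1 / 2 + 1 := by omega
    have e3 : ((2 + i.1) % 2 = 0 ∧ 2 + j.1 = 2 + i.1 + 1) ↔ (i.1 % 2 = 0 ∧ j.1 = i.1 + 1) := by
      omega
    have e4 : ((2 + j.1) % 2 = 0 ∧ 2 + i.1 = 2 + j.1 + 1) ↔ (j.1 % 2 = 0 ∧ i.1 = j.1 + 1) := by
      omega
    simp only [e1, e2, e3, e4]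

theorem diag_eq_zero_of_skew {ι : Type*} {A : Matrix ι ι (PowerSeries ℂ)} (hA : A.transpose = -A)
    (i : ι) : A i i = 0 :=
  PowerSeries.ext fun n => by
    have h := congrArg (PowerSeries.coeff n) (congrFun (congrFun hA i) i)
    simpa [self_eq_neg] using h

/-- A skew-symmetric matrix with an invertible leading `2 × 2` block is congruent to the direct
sum of a hyperbolic plane and its Schur complement. -/
theorem exists_congr_fromBlocks {ι : Type*} [Fintype ι] [DecidableEq ι]
    {M : Matrix (Fin 2 ⊕ ι) (Fin 2 ⊕ ι) (PowerSeries ℂ)} (hM : M.transpose = -M)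
    (hu : IsUnit (M (Sum.inl 0) (Sum.inl 1))) :
    ∃ L : Matrix (Fin 2 ⊕ ι) (Fin 2 ⊕ ι) (PowerSeries ℂ), IsUnit L ∧
      ∃ D : Matrix ι ι (PowerSeries ℂ), D.transpose = -D ∧
        M = L * Matrix.fromBlocks !![0, 1; -1, 0] 0 0 D * L.transpose := by
  set c := M (Sum.inl 0) (Sum.inl 1) with hc
  set K := M.toBlocks₁₁ with hK
  set B := M.toBlocks₁₂ with hB
  set C := M.toBlocks₂₁ with hC
  set D := M.toBlocks₂₂ with hD
  have hMb : M = Matrix.fromBlocks K B C D := (Matrix.fromBlocks_toBlocks M).symm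
  have hent : ∀ i j, M j i = -M i j := fun i j => congrFun (congrFun hM i) j
  have hKt : K.transpose = -K := Matrix.ext fun i j => hent _ _
  have hDt : D.transpose = -D := Matrix.ext fun i j => hent _ _
  have hBt : B.transpose = -C := Matrix.ext fun i j => hent _ _
  have hCt : C.transpose = -B := by rw [← neg_eq_iff_eq_neg.2 hBt]; simp
  have htr : (!![c, 0; 0, 1] : Matrix (Fin 2) (Fin 2) (PowerSeries ℂ)).transpose =
      !![c, 0; 0, 1] := by
    refine Matrix.ext fun i j => ?_
    fin_cases i <;> fin_cases j <;> rfl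
  have hKe : K = !![c, 0; 0, 1] * !![0, 1; -1, 0] * (!![c, 0; 0, 1]).transpose := by
    rw [htr]
    refine Matrix.ext fun i j => ?_
    fin_cases i <;> fin_cases j
    · simpa [hK, Matrix.toBlocks₁₁] using diag_eq_zero_of_skew hM (Sum.inl 0)
    · simp [hK, Matrix.toBlocks₁₁, hc]
    · simp [hK, Matrix.toBlocks₁₁, hc, hent (Sum.inl 0) (Sum.inl 1)]
    · simpa [hK, Matrix.toBlocks₁₁] using diag_eq_zero_of_skew hM (Sum.inl 1)
  have hh : IsUnit (!![c, 0; 0, 1] : Matrix (Fin 2) (Fin 2) (PowerSeries ℂ)) := by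
    rw [Matrix.isUnit_iff_isUnit_det, Matrix.det_fin_two_of]
    simpa using hu
  have hKu : IsUnit K := by
    rw [hKe, Matrix.isUnit_iff_isUnit_det]
    rw [Matrix.isUnit_iff_isUnit_det] at hh
    rw [Matrix.det_mul, Matrix.det_mul, Matrix.det_transpose]
    refine (hh.mul ?_).mul hh
    simp [Matrix.det_fin_two_of]
  let _ : Invertible K := hKu.invertible
  have hKinv : (⅟K).transpose = -⅟K := by
    have h1 : K.transpose * (⅟K).transpose = 1 := by
      rw [← Matrix.transpose_mul, invOf_mul_self, Matrix.transpose_one]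
    rw [hKt, neg_mul] at h1
    calc (⅟K).transpose = ⅟K * (K * (⅟K).transpose) := by
          rw [← mul_assoc, invOf_mul_self, one_mul]
      _ = -⅟K := by rw [← neg_eq_iff_eq_neg.2 h1.symm, mul_neg, mul_one]
  have hLt : (Matrix.fromBlocks (1 : Matrix (Fin 2) (Fin 2) (PowerSeries ℂ)) 0 (C * ⅟K)
      (1 : Matrix ι ι (PowerSeries ℂ))).transpose = Matrix.fromBlocks 1 (⅟K * B) 0 1 := by
    rw [Matrix.fromBlocks_transpose, Matrix.transpose_mul, hKinv, hCt]
    simp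
  refine ⟨Matrix.fromBlocks 1 0 (C * ⅟K) 1 * Matrix.fromBlocks !![c, 0; 0, 1] 0 0 1, ?_,
    D - C * ⅟K * B, ?_, ?_⟩
  · refine IsUnit.mul ?_ ?_
    · rw [Matrix.isUnit_fromBlocks_zero₁₂]; exact ⟨isUnit_one, isUnit_one⟩
    · rw [Matrix.isUnit_fromBlocks_zero₁₂]; exact ⟨hh, isUnit_one⟩
  · rw [Matrix.transpose_sub, Matrix.transpose_mul, Matrix.transpose_mul, hDt, hBt, hCt, hKinv]
    simp only [Matrix.mul_neg, Matrix.neg_mul, neg_neg, Matrix.mul_assoc]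
    abel
  · conv_lhs => rw [hMb, Matrix.fromBlocks_eq_of_invertible₁₁]
    rw [Matrix.transpose_mul, hLt]
    have h2 : ∀ D' : Matrix ι ι (PowerSeries ℂ), Matrix.fromBlocks K 0 0 D' =
        Matrix.fromBlocks !![c, 0; 0, 1] 0 0 1 * Matrix.fromBlocks !![0, 1; -1, 0] 0 0 D' *
          (Matrix.fromBlocks !![c, 0; 0, 1] 0 0 1).transpose := by
      intro D'
      rw [Matrix.fromBlocks_transpose, Matrix.fromBlocks_multiply, Matrix.fromBlocks_multiply,
        Matrix.transpose_one]
      conv_lhs => rw [hKe]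
      simp
    rw [h2]
    simp only [Matrix.mul_assoc]

theorem exists_perm_apply_eq {ι : Type*} [DecidableEq ι] {x y i j : ι} (hxy : x ≠ y)
    (hij : i ≠ j) : ∃ σ : Equiv.Perm ι, σ x = i ∧ σ y = j := by
  refine ⟨Equiv.swap x i * Equiv.swap y (Equiv.swap x i j), ?_, ?_⟩
  · have h : x ≠ Equiv.swap x i j := by
      intro h
      apply hij
      simpa using congrArg (Equiv.swap x i) h
    rw [Equiv.Perm.mul_apply, Equiv.swap_apply_of_ne_of_ne hxy h, Equiv.swap_apply_left]
  · rw [Equiv.Perm.mul_apply, Equiv.swap_apply_left, Equiv.swap_apply_self]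

/-- An entry of minimal order of a nonzero skew-symmetric matrix of power series. -/
theorem exists_pivot {ι : Type*} [Finite ι] {A : Matrix ι ι (PowerSeries ℂ)}
    (hA : A.transpose = -A) (h0 : A ≠ 0) :
    ∃ (n : ℕ) (A' : Matrix ι ι (PowerSeries ℂ)), A = (PowerSeries.X ^ n : PowerSeries ℂ) • A' ∧
      A'.transpose = -A' ∧ ∃ i j, i ≠ j ∧ IsUnit (A' i j) := by
  obtain ⟨i₀, j₀, hij₀⟩ : ∃ i j, A i j ≠ 0 := by
    by_contra! h
    exact h0 (by ext i j; simp [h i j])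
  have : Nonempty (ι × ι) := ⟨(i₀, j₀)⟩
  obtain ⟨⟨i, j⟩, hmin⟩ := Finite.exists_min fun x : ι × ι => (A x.1 x.2).order
  have hne : A i j ≠ 0 := by
    intro h
    have := hmin (i₀, j₀)
    simp only [h, PowerSeries.order_zero, top_le_iff, PowerSeries.order_eq_top] at this
    exact hij₀ this
  set n := (A i j).order.toNat with hn
  have hord : (A i j).order = n := by
    rw [hn, ENat.natCast_toNat (by simpa using hne)]
  have hdvd : ∀ u v, ∃ f, A u v = (PowerSeries.X ^ n : PowerSeries ℂ) * f := by
    intro u v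
    refine PowerSeries.X_pow_dvd_iff.2 fun k hk => PowerSeries.coeff_of_lt_order k ?_
    refine lt_of_lt_of_le ?_ (hmin (u, v))
    simp only [hord]
    exact_mod_cast hk
  choose A' hA' using hdvd
  have hX : (PowerSeries.X ^ n : PowerSeries ℂ) ≠ 0 := pow_ne_zero _ PowerSeries.X_ne_zero
  refine ⟨n, Matrix.of A', Matrix.ext fun u v => by simp [hA'], ?_, i, j, ?_, ?_⟩
  · refine Matrix.ext fun u v => ?_
    apply mul_left_cancel₀ hX
    have := congrFun (congrFun hA u) v
    simp only [Matrix.transpose_apply, Matrix.neg_apply, Matrix.of_apply] at this ⊢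
    rw [mul_neg, ← hA', ← hA', this]
  · rintro rfl
    exact hne (diag_eq_zero_of_skew hA i)
  · rw [Matrix.of_apply, PowerSeries.isUnit_iff_constantCoeff, isUnit_iff_ne_zero,
      ← PowerSeries.coeff_zero_eq_constantCoeff_apply]
    have h1 := PowerSeries.coeff_order hne
    rw [← hn, hA' i j, PowerSeries.coeff_X_pow_mul'] at h1
    simpa using h1

/-- Every skew-symmetric matrix of power series is congruent to a block diagonal matrix whose
blocks are multiples of `J` by powers of `t` with nondecreasing exponents. -/
theorem exists_eq_mul_stdSkew_mul_transpose (m : ℕ) :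
    ∀ A : Matrix (Fin m) (Fin m) (PowerSeries ℂ), A.transpose = -A →
      ∃ (a : ℕ → ℕ∞) (g : Matrix (Fin m) (Fin m) (PowerSeries ℂ)), Monotone a ∧ IsUnit g ∧
        A = g * stdSkew m (fun q => tPow (a q.1)) * g.transpose := by
  induction m using Nat.strong_induction_on with
  | _ m ih =>
    intro A hA
    by_cases h0 : A = 0
    · refine ⟨fun _ => ⊤, 1, monotone_const, isUnit_one, ?_⟩
      simp [h0, tPow_top, stdSkew]
    obtain ⟨n, A', hAA', hA', i, j, hij, hu⟩ := exists_pivot hA h0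
    obtain ⟨m, rfl⟩ : ∃ m', m = 2 + m' := by
      refine exists_add_of_le ?_
      have hi := i.2
      have hj := j.2
      have : i.1 ≠ j.1 := fun h => hij (Fin.ext h)
      omega
    let e : Fin 2 ⊕ Fin m ≃ Fin (2 + m) := finSumFinEquiv
    obtain ⟨σ, hσi, hσj⟩ := exists_perm_apply_eq
      (show e (Sum.inl 0) ≠ e (Sum.inl 1) by simp [e]) hij
    let τ := e.trans σ
    obtain ⟨L, hL, D, hD, hM⟩ := exists_congr_fromBlocks (M := A'.submatrix τ τ)
      (by rw [Matrix.transpose_submatrix, hA']; rfl)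
      (by simpa [τ, hσi, hσj] using hu)
    obtain ⟨a, g, ha, hg, hDg⟩ := ih m (by omega) D hD
    let a' : ℕ → ℕ∞ := fun q => (n : ℕ∞) + Nat.casesOn q 0 a
    let G := L * Matrix.fromBlocks 1 0 0 g
    have hG : IsUnit G := by
      refine hL.mul ?_
      rw [Matrix.isUnit_fromBlocks_zero₁₂]
      exact ⟨isUnit_one, hg⟩
    have hstd : (stdSkew (2 + m) (fun q => tPow (a' q.1))).submatrix e e =
        (PowerSeries.X ^ n : PowerSeries ℂ) •
          Matrix.fromBlocks !![0, 1; -1, 0] 0 0 (stdSkew m (fun q => tPow (a q.1))) := by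
      have ht : ∀ q, tPow (a' q) =
          (PowerSeries.X ^ n : PowerSeries ℂ) * tPow (Nat.casesOn q 0 a) := fun q => by
        rw [tPow_add, tPow_coe]
      rw [stdSkew_submatrix_finSumFinEquiv fun q => tPow (a' q), Matrix.fromBlocks_smul]
      congr 1
      · simp [ht, tPow_zero]
      · simp
      · simp
      · simp only [ht, stdSkew, Finset.smul_sum, smul_sub, Matrix.smul_single, smul_eq_mul]
    refine ⟨a', G.submatrix τ.symm e.symm, ?_, ?_, ?_⟩
    · refine monotone_nat_of_le_succ fun q => add_le_add_right ?_ _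
      cases q with
      | zero => exact bot_le
      | succ q => exact ha (Nat.le_succ q)
    · exact (Matrix.isUnit_submatrix_equiv _ _).2 hG
    · have hA1 : A = (A.submatrix τ τ).submatrix τ.symm τ.symm := by simp
      have hs : stdSkew (2 + m) (fun q => tPow (a' q.1)) =
          ((stdSkew (2 + m) (fun q => tPow (a' q.1))).submatrix e e).submatrix e.symm e.symm := by
        simp
      rw [hs, Matrix.transpose_submatrix, Matrix.submatrix_mul_equiv, Matrix.submatrix_mul_equiv,
        hstd, hA1]
      congr 1
      rw [hAA']
      change (PowerSeries.X ^ n : PowerSeries ℂ) • A'.submatrix τ τ = _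
      rw [hM, hDg]
      simp only [G, Matrix.transpose_mul, Matrix.fromBlocks_transpose, Matrix.mul_smul,
        Matrix.smul_mul, Matrix.mul_assoc]
      congr 2
      simp only [← Matrix.mul_assoc]
      congr 1
      simp [Matrix.fromBlocks_multiply]

/-! ### Lifting jets to matrices of power series -/

theorem jetPow_min (l e : ℕ∞) : jetPow l (min e (l + 1)) = jetPow l e := by
  rcases le_total e (l + 1) with h | h
  · rw [min_eq_left h]
  · have h0 : ∀ x, l + 1 ≤ x → jetPow l x = 0 := fun x hx =>
      Ideal.Quotient.eq_zero_iff_mem.2 (mem_jetIdeal_iff.2 (tPow_dvd_tPow_iff.2 hx))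
    rw [min_eq_right h, h0 _ le_rfl, h0 _ h]

theorem nontrivial_jetRing (l : ℕ∞) : Nontrivial (JetRing l) := by
  refine Ideal.Quotient.nontrivial_iff.2 ((Ideal.ne_top_iff_one _).2 fun h => ?_)
  rw [mem_jetIdeal_iff, ← tPow_zero, tPow_dvd_tPow_iff] at h
  simp at h

theorem isUnit_of_isUnit_map_mk {m : ℕ} {l : ℕ∞} {G : Matrix (Fin m) (Fin m) (PowerSeries ℂ)}
    (h : IsUnit (G.map (Ideal.Quotient.mk (jetIdeal l)))) : IsUnit G := by
  have := nontrivial_jetRing l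
  have := IsLocalHom.of_surjective (Ideal.Quotient.mk (jetIdeal l)) Ideal.Quotient.mk_surjective
  rw [Matrix.isUnit_iff_isUnit_det] at h ⊢
  rw [← RingHom.mapMatrix_apply, ← RingHom.map_det] at h
  exact isUnit_of_map_unit _ _ h

theorem map_mk_congr {m : ℕ} (l : ℕ∞) (G : Matrix (Fin m) (Fin m) (PowerSeries ℂ))
    (a : Fin (m / 2) → ℕ∞) :
    (G * stdSkew m (fun q => tPow (a q)) * G.transpose).map (Ideal.Quotient.mk (jetIdeal l)) =
      G.map (Ideal.Quotient.mk (jetIdeal l)) * blockMatrix m l a *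
        (G.map (Ideal.Quotient.mk (jetIdeal l))).transpose := by
  rw [Matrix.map_mul, Matrix.map_mul, stdSkew_map, Matrix.transpose_map, blockMatrix_eq]
  rfl

/-- Since `ℂ⟦t⟧` is local, `GL_m` of the jet ring lifts to `GL_m(ℂ⟦t⟧)`. -/
theorem mem_congruenceOrbit_iff {m : ℕ} {l : ℕ∞} {a : Fin (m / 2) → ℕ∞} {A : SkewJet m l} :
    A ∈ congruenceOrbit m l a ↔ ∃ G : Matrix (Fin m) (Fin m) (PowerSeries ℂ), IsUnit G ∧
      A.1 = (G * stdSkew m (fun q => tPow (a q)) * G.transpose).map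
        (Ideal.Quotient.mk (jetIdeal l)) := by
  constructor
  · rintro ⟨g, hg⟩
    choose G hG using fun i j => Ideal.Quotient.mk_surjective (I := jetIdeal l) (g.1 i j)
    have hGg : (Matrix.of G).map (Ideal.Quotient.mk (jetIdeal l)) = g.1 :=
      Matrix.ext fun i j => hG i j
    refine ⟨Matrix.of G, isUnit_of_isUnit_map_mk (l := l) (hGg ▸ g.isUnit), ?_⟩
    rw [map_mk_congr, hGg]
    exact hg
  · rintro ⟨G, hG, hA⟩
    rw [map_mk_congr] at hA
    exact ⟨(hG.map (Ideal.Quotient.mk (jetIdeal l)).mapMatrix).unit, hA⟩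

theorem exists_skew_lift {m : ℕ} {l : ℕ∞} (A : SkewJet m l) :
    ∃ M : Matrix (Fin m) (Fin m) (PowerSeries ℂ), M.transpose = -M ∧
      M.map (Ideal.Quotient.mk (jetIdeal l)) = A.1 := by
  choose L hL using fun i j => Ideal.Quotient.mk_surjective (I := jetIdeal l) (A.1 i j)
  refine ⟨Matrix.of fun i j => (2⁻¹ : ℂ) • (L i j - L j i), ?_, ?_⟩
  · refine Matrix.ext fun i j => ?_
    simp only [Matrix.transpose_apply, Matrix.of_apply, Matrix.neg_apply]
    rw [← smul_neg, neg_sub]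
  · refine Matrix.ext fun i j => ?_
    have h : A.1 j i = -A.1 i j := congrFun (congrFun A.2 i) j
    have hs : ∀ f : PowerSeries ℂ, Ideal.Quotient.mk (jetIdeal l) ((2⁻¹ : ℂ) • f) =
        (2⁻¹ : ℂ) • Ideal.Quotient.mk (jetIdeal l) f := fun f =>
      map_smul (Ideal.Quotient.mkₐ ℂ (jetIdeal l)) _ f
    rw [Matrix.map_apply, Matrix.of_apply, hs, map_sub, hL, hL, h, sub_neg_eq_add,
      ← two_smul ℂ (A.1 i j), smul_smul, inv_mul_cancel₀ two_ne_zero, one_smul]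

/-! ### Contact loci in terms of Pfaffian orders -/

theorem map_pfaffianIdeal_le_iff {m k : ℕ} {l e : ℕ∞} (he : e ≤ l + 1) {A : SkewJet m l}
    {M : Matrix (Fin m) (Fin m) (PowerSeries ℂ)}
    (hM : M.map (Ideal.Quotient.mk (jetIdeal l)) = A.1) :
    (pfaffianIdeal m k).map A.comorphism ≤ Ideal.span {jetPow l e} ↔ PfaffianOrderGE k M e := by
  rw [pfaffianIdeal, Ideal.map_span, Ideal.span_le, ← Set.range_comp, Set.range_subset_iff]
  refine forall_congr' fun r => ?_
  have hgen : ((genericSkew m).submatrix r r).map A.comorphism =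
      (M.submatrix r r).map (Ideal.Quotient.mkₐ ℂ (jetIdeal l)) := by
    refine Matrix.ext fun i j => ?_
    have h1 : A.comorphism (genericSkew m (r i) (r j)) = A.1 (r i) (r j) := by
      change MvPolynomial.aeval _ (MvPolynomial.X (r i, r j)) = _
      rw [MvPolynomial.aeval_X]
    exact h1.trans (congrFun (congrFun hM (r i)) (r j)).symm
  rw [Function.comp_apply, SetLike.mem_coe, Ideal.mem_span_singleton]
  have h2 : A.comorphism (pfaffian k ((genericSkew m).submatrix r r)) =
      Ideal.Quotient.mk (jetIdeal l) (pfaffian k (M.submatrix r r)) := by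
    rw [← pfaffian_map, hgen, pfaffian_map]
    rfl
  exact (by rw [← h2] : _ ↔ jetPow l e ∣ Ideal.Quotient.mk (jetIdeal l) _).trans
    (jetPow_dvd_mk_iff he)

theorem mem_contactLocus_iff {m k p : ℕ} {l : ℕ∞} (hp : (p : ℕ∞) ≤ l) {A : SkewJet m l}
    {M : Matrix (Fin m) (Fin m) (PowerSeries ℂ)}
    (hM : M.map (Ideal.Quotient.mk (jetIdeal l)) = A.1) :
    A ∈ contactLocus (pfaffianIdeal m k) p l ↔
      PfaffianOrderGE k M p ∧ ¬ PfaffianOrderGE k M (p + 1 : ℕ) := by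
  have hp1 : ((p + 1 : ℕ) : ℕ∞) ≤ l + 1 := by
    push_cast
    exact add_le_add_left hp 1
  rw [contactLocus, Set.mem_ofPred_eq, map_pfaffianIdeal_le_iff (hp.trans le_self_add) hM,
    map_pfaffianIdeal_le_iff hp1 hM]

/-- The Pfaffian orders of a matrix of power series are the partial sums of the exponents in its
normal form. -/
theorem pfaffianOrderGE_congr_iff {m k : ℕ} (hk : k ≤ m / 2) {a : Fin (m / 2) → ℕ∞}
    (ha : Monotone a) {G : Matrix (Fin m) (Fin m) (PowerSeries ℂ)} (hG : IsUnit G) {e : ℕ∞} :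
    PfaffianOrderGE k (G * stdSkew m (fun q => tPow (a q)) * G.transpose) e ↔
      e ≤ partialSum a k := by
  constructor
  · intro h
    obtain ⟨H, hHG⟩ := hG.exists_left_inv
    have h1 := h.mul_mul_transpose H
    have h2 : H * (G * stdSkew m (fun q => tPow (a q)) * G.transpose) * H.transpose =
        stdSkew m (fun q => tPow (a q)) := by
      calc _ = (H * G) * stdSkew m (fun q => tPow (a q)) * (H * G).transpose := by
            rw [Matrix.transpose_mul]
            simp only [Matrix.mul_assoc]
        _ = _ := by rw [hHG]; simp
    rw [h2] at h1
    exact le_partialSum_of_pfaffianOrderGE_stdSkew hk h1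
  · intro h
    have hs := pfaffianOrderGE_stdSkew_add (k := k) (l := ⊤) (b := a) ⟨ha, fun _ => le_top⟩ 0
    rw [smul_zero, add_zero] at hs
    exact fun r => (tPow_dvd_tPow_iff.2 h).trans (hs.mul_mul_transpose G r)

theorem mem_contactLocus_iff_partialSum_eq {m k p : ℕ} (hk : k ≤ m / 2) {l : ℕ∞} (hp : (p : ℕ∞) ≤ l)
    {a : Fin (m / 2) → ℕ∞} (ha : Monotone a) {G : Matrix (Fin m) (Fin m) (PowerSeries ℂ)}
    (hG : IsUnit G) {A : SkewJet m l}
    (hA : (G * stdSkew m (fun q => tPow (a q)) * G.transpose).map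
      (Ideal.Quotient.mk (jetIdeal l)) = A.1) :
    A ∈ contactLocus (pfaffianIdeal m k) p l ↔ partialSum a k = p := by
  rw [mem_contactLocus_iff hp hA, pfaffianOrderGE_congr_iff hk ha hG,
    pfaffianOrderGE_congr_iff hk ha hG, not_le]
  push_cast
  rw [ENat.lt_add_one_iff (ENat.natCast_ne_top p), and_comm, le_antisymm_iff]

theorem contactLocus_eq_iUnion {m k p : ℕ} (hk : k ≤ m / 2) {l : ℕ∞} (hp : (p : ℕ∞) ≤ l) :
    contactLocus (pfaffianIdeal m k) p l =
      ⋃ a ∈ LambdaContact (m / 2) k p l, congruenceOrbit m l a := by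
  ext A
  simp only [Set.mem_iUnion, exists_prop]
  constructor
  · intro hA
    obtain ⟨M, hM, hMA⟩ := exists_skew_lift A
    obtain ⟨a, G, ha, hG, rfl⟩ := exists_eq_mul_stdSkew_mul_transpose m M hM
    have ha' : Monotone fun q : Fin (m / 2) => a q.1 := fun _ _ h => ha h
    have hsum := (mem_contactLocus_iff_partialSum_eq hk hp ha' hG hMA).1 hA
    refine ⟨fun q => min (a q.1) (l + 1), ⟨⟨fun i j h => min_le_min_right _ (ha' h),
      fun i => min_le_right _ _⟩, ?_⟩, mem_congruenceOrbit_iff.2 ⟨G, hG, ?_⟩⟩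
    · rw [← hsum]
      refine Finset.sum_congr rfl fun i hi => min_eq_left ?_
      calc a i.1 ≤ partialSum (fun q : Fin (m / 2) => a q.1) k :=
            Finset.single_le_sum (f := fun q : Fin (m / 2) => a q.1) (fun _ _ => bot_le) hi
        _ ≤ l + 1 := hsum.le.trans (hp.trans le_self_add)
    · rw [← hMA, map_mk_congr, map_mk_congr, blockMatrix_eq, blockMatrix_eq]
      simp only [jetPow_min]
  · rintro ⟨a, ha, hA⟩
    obtain ⟨G, hG, hGA⟩ := mem_congruenceOrbit_iff.1 hA
    exact (mem_contactLocus_iff_partialSum_eq hk hp ha.1.1 hG hGA.symm).2 ha.2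

theorem partialSum_le_of_mem_inter {m : ℕ} {l : ℕ∞} {a b : Fin (m / 2) → ℕ∞}
    (hb : b ∈ LambdaSet (m / 2) l) {A : SkewJet m l} (hAa : A ∈ congruenceOrbit m l a)
    (hAb : A ∈ congruenceOrbit m l b) {k : ℕ} (hk : k ≤ m / 2) :
    partialSum b k ≤ partialSum a k := by
  obtain ⟨G, hG, hGA⟩ := mem_congruenceOrbit_iff.1 hAa
  obtain ⟨H, hH, hHA⟩ := mem_congruenceOrbit_iff.1 hAb
  have hS : ∀ i j, ∃ s, (G * stdSkew m (fun q => tPow (a q)) * G.transpose) i j =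
      (H * stdSkew m (fun q => tPow (b q)) * H.transpose) i j + tPow (l + 1) * s := by
    intro i j
    have h : Ideal.Quotient.mk (jetIdeal l) _ = Ideal.Quotient.mk (jetIdeal l) _ :=
      congrFun (congrFun (hGA.symm.trans hHA) i) j
    rw [Ideal.Quotient.eq, mem_jetIdeal_iff] at h
    obtain ⟨s, hs⟩ := h
    exact ⟨s, by rw [← hs, add_sub_cancel]⟩
  choose S hS using hS
  obtain ⟨G', hG'⟩ := hG.exists_left_inv
  obtain ⟨H', hH'⟩ := hH.exists_right_inv
  have hHt : H'.transpose * H.transpose = 1 := by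
    rw [← Matrix.transpose_mul, hH', Matrix.transpose_one]
  have hGt : G.transpose * G'.transpose = 1 := by
    rw [← Matrix.transpose_mul, hG', Matrix.transpose_one]
  have heq : stdSkew m (fun q => tPow (a q)) = (G' * H) *
      (stdSkew m (fun q => tPow (b q)) + tPow (l + 1) • (H' * Matrix.of S * H'.transpose)) *
        (G' * H).transpose := by
    have h1 : G * stdSkew m (fun q => tPow (a q)) * G.transpose =
        H * stdSkew m (fun q => tPow (b q)) * H.transpose + tPow (l + 1) • Matrix.of S :=
      Matrix.ext fun i j => hS i j
    have h2 : tPow (l + 1) • Matrix.of S =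
        H * (tPow (l + 1) • (H' * Matrix.of S * H'.transpose)) * H.transpose := by
      calc tPow (l + 1) • Matrix.of S =
          tPow (l + 1) • ((H * H') * Matrix.of S * (H'.transpose * H.transpose)) := by
            rw [hH', hHt, Matrix.one_mul, Matrix.mul_one]
        _ = _ := by simp only [Matrix.mul_smul, Matrix.smul_mul, Matrix.mul_assoc]
    calc stdSkew m (fun q => tPow (a q)) =
          (G' * G) * stdSkew m (fun q => tPow (a q)) * (G.transpose * G'.transpose) := by
            rw [hG', hGt, Matrix.one_mul, Matrix.mul_one]
      _ = G' * (G * stdSkew m (fun q => tPow (a q)) * G.transpose) * G'.transpose := by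
            simp only [Matrix.mul_assoc]
      _ = _ := by
            rw [h1, h2, Matrix.transpose_mul, ← Matrix.add_mul, ← Matrix.mul_add]
            simp only [Matrix.mul_assoc]
  refine le_partialSum_of_pfaffianOrderGE_stdSkew hk ?_
  rw [heq]
  exact (pfaffianOrderGE_stdSkew_add hb _).mul_mul_transpose _

theorem pairwiseDisjoint_congruenceOrbit (m : ℕ) (l : ℕ∞) :
    (LambdaSet (m / 2) l).PairwiseDisjoint (congruenceOrbit m l) := by
  intro a ha b hb hab
  refine Set.disjoint_left.2 fun A hAa hAb => hab ?_
  exact eq_of_partialSum_eq ha.1 hb.1 fun k hk => le_antisymm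
    (partialSum_le_of_mem_inter ha hAb hAa hk) (partialSum_le_of_mem_inter hb hAa hAb hk)

/-! ### The Zariski topology on spaces of jets -/

theorem isClosed_skewJet_iff {m : ℕ} {l : ℕ∞} {Z : Set (SkewJet m l)} :
    IsClosed Z ↔ ∃ S, Z = jetZeroLocus m l S := by
  rw [← isOpen_compl_iff]
  change Zᶜᶜ ∈ {Z | ∃ S, Z = jetZeroLocus m l S} ↔ _
  rw [compl_compl]
  rfl

theorem mem_closure_skewJet_iff {m : ℕ} {l : ℕ∞} {S : Set (SkewJet m l)} {A : SkewJet m l} :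
    A ∈ closure S ↔ ∀ F : MvPolynomial (Fin m × Fin m × {k : ℕ // (k : ℕ∞) ≤ l}) ℂ,
      (∀ B ∈ S, MvPolynomial.eval B.coord F = 0) → MvPolynomial.eval A.coord F = 0 := by
  constructor
  · intro hA F hF
    have hcl : IsClosed (jetZeroLocus m l {F}) := isClosed_skewJet_iff.2 ⟨_, rfl⟩
    have hsub : S ⊆ jetZeroLocus m l {F} := by
      rintro B hB _ rfl
      exact hF B hB
    exact closure_minimal hsub hcl hA F rfl
  · intro h
    obtain ⟨T, hT⟩ := isClosed_skewJet_iff.1 (isClosed_closure (s := S))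
    rw [hT]
    intro F hF
    refine h F fun B hB => ?_
    have : B ∈ jetZeroLocus m l T := hT ▸ subset_closure hB
    exact this F hF

theorem exists_eval_ne_zero_of_mem_open {m : ℕ} {l : ℕ∞} {U : Set (SkewJet m l)} (hU : IsOpen U)
    {A : SkewJet m l} (hA : A ∈ U) :
    ∃ F : MvPolynomial (Fin m × Fin m × {k : ℕ // (k : ℕ∞) ≤ l}) ℂ,
      MvPolynomial.eval A.coord F ≠ 0 ∧ ∀ B, MvPolynomial.eval B.coord F ≠ 0 → B ∈ U := by
  have h : A ∉ closure Uᶜ := by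
    rw [hU.isClosed_compl.closure_eq]
    simpa using hA
  rw [mem_closure_skewJet_iff] at h
  push Not at h
  obtain ⟨F, hF, hAF⟩ := h
  refine ⟨F, hAF, fun B hB => ?_⟩
  by_contra hBU
  exact hB (hF B hBU)

theorem coord_eq_coeff {m : ℕ} {l : ℕ∞} {A : SkewJet m l}
    {M : Matrix (Fin m) (Fin m) (PowerSeries ℂ)}
    (hM : M.map (Ideal.Quotient.mk (jetIdeal l)) = A.1)
    (x : Fin m × Fin m × {k : ℕ // (k : ℕ∞) ≤ l}) :
    A.coord x = PowerSeries.coeff x.2.2.1 (M x.1 x.2.1) := by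
  rw [SkewJet.coord, ← hM]
  rfl

/-- The condition that the Pfaffians of size `2 k` have order at least `e` is closed: their
coefficients are polynomials in the coefficients of the entries, as is seen by computing with the
matrix of power series whose coefficients are independent variables. -/
theorem PfaffianOrderGE.of_mem_closure {m k : ℕ} {e : ℕ∞} {S : Set (SkewJet m ⊤)}
    {A : SkewJet m ⊤} (hA : A ∈ closure S) {M : Matrix (Fin m) (Fin m) (PowerSeries ℂ)}
    (hM : M.map (Ideal.Quotient.mk (jetIdeal ⊤)) = A.1)
    (hS : ∀ B ∈ S, ∃ N : Matrix (Fin m) (Fin m) (PowerSeries ℂ),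
      N.map (Ideal.Quotient.mk (jetIdeal ⊤)) = B.1 ∧ PfaffianOrderGE k N e) :
    PfaffianOrderGE k M e := by
  intro r
  rw [tPow_dvd_iff]
  intro j hj
  let X := Fin m × Fin m × {k : ℕ // (k : ℕ∞) ≤ ⊤}
  let U : Matrix (Fin m) (Fin m) (PowerSeries (MvPolynomial X ℂ)) := Matrix.of fun u v =>
    PowerSeries.mk fun i => MvPolynomial.X ((u, v, ⟨i, le_top⟩) : X)
  have key : ∀ (B : SkewJet m ⊤) (N : Matrix (Fin m) (Fin m) (PowerSeries ℂ)),
      N.map (Ideal.Quotient.mk (jetIdeal ⊤)) = B.1 →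
      MvPolynomial.eval B.coord (PowerSeries.coeff j (pfaffian k (U.submatrix r r))) =
        PowerSeries.coeff j (pfaffian k (N.submatrix r r)) := by
    intro B N hN
    let φ : PowerSeries (MvPolynomial X ℂ) →ₐ[ℂ] PowerSeries ℂ :=
      PowerSeries.mapAlgHom (MvPolynomial.aeval B.coord)
    have hUN : (U.submatrix r r).map φ = N.submatrix r r := by
      refine Matrix.ext fun u v => PowerSeries.ext fun i => ?_
      have h1 : PowerSeries.coeff i (φ (U (r u) (r v))) =
          MvPolynomial.aeval B.coord (PowerSeries.coeff i (U (r u) (r v))) :=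
        PowerSeries.coeff_map _ _ _
      refine h1.trans ?_
      simp only [U, Matrix.of_apply, PowerSeries.coeff_mk, MvPolynomial.aeval_X]
      exact coord_eq_coeff hN _
    rw [← hUN, pfaffian_map]
    exact (PowerSeries.coeff_map _ _ _).symm
  rw [← key A M hM]
  refine mem_closure_skewJet_iff.1 hA _ fun B hB => ?_
  obtain ⟨N, hN, hNe⟩ := hS B hB
  rw [key B N hN]
  exact tPow_dvd_iff.1 (hNe r) j hj

/-! ### Polynomial families of arcs -/

/-- The families of power series, indexed by `s : ℂ`, whose coefficients are polynomials in `s`. -/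
noncomputable def polyFamily : Subring (ℂ → PowerSeries ℂ) :=
  (RingHom.pi fun s : ℂ => PowerSeries.map (Polynomial.evalRingHom s)).range

theorem mem_polyFamily_iff {f : ℂ → PowerSeries ℂ} : f ∈ polyFamily ↔
    ∃ F : PowerSeries (Polynomial ℂ), ∀ s, PowerSeries.map (Polynomial.evalRingHom s) F = f s :=
  exists_congr fun _ => funext_iff

theorem const_mem_polyFamily (f : PowerSeries ℂ) : (fun _ => f) ∈ polyFamily :=
  mem_polyFamily_iff.2 ⟨PowerSeries.map Polynomial.C f, fun s => by ext k; simp⟩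

theorem C_mem_polyFamily : (fun s => PowerSeries.C s) ∈ polyFamily :=
  mem_polyFamily_iff.2 ⟨PowerSeries.C Polynomial.X, fun s => by simp⟩

theorem exists_coeff_eq_eval {f : ℂ → PowerSeries ℂ} (hf : f ∈ polyFamily) (k : ℕ) :
    ∃ P : Polynomial ℂ, ∀ s, PowerSeries.coeff k (f s) = P.eval s := by
  obtain ⟨F, hF⟩ := mem_polyFamily_iff.1 hf
  exact ⟨PowerSeries.coeff k F, fun s => by simp [← hF]⟩

theorem matrix_mul_mem_polyFamily {m : ℕ} {M : ℂ → Matrix (Fin m) (Fin m) (PowerSeries ℂ)}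
    (hM : ∀ i j, (fun s => M s i j) ∈ polyFamily)
    {N : ℂ → Matrix (Fin m) (Fin m) (PowerSeries ℂ)}
    (hN : ∀ i j, (fun s => N s i j) ∈ polyFamily) (i j : Fin m) :
    (fun s => (M s * N s) i j) ∈ polyFamily := by
  have h : (fun s => (M s * N s) i j) =
      ∑ x, (fun s => M s i x) * (fun s => N s x j) := by
    funext s
    simp [Matrix.mul_apply]
  rw [h]
  exact sum_mem fun x _ => mul_mem (hM i x) (hN x j)

theorem det_mem_polyFamily {m : ℕ} {M : ℂ → Matrix (Fin m) (Fin m) (PowerSeries ℂ)}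
    (hM : ∀ i j, (fun s => M s i j) ∈ polyFamily) : (fun s => (M s).det) ∈ polyFamily := by
  have h : (fun s => (M s).det) = ∑ σ : Equiv.Perm (Fin m),
      (((Equiv.Perm.sign σ : ℤˣ) : ℤ) : ℂ → PowerSeries ℂ) * ∏ i, (fun s => M s (σ i) i) := by
    funext s
    simp [Matrix.det_apply']
  rw [h]
  exact sum_mem fun σ _ => mul_mem (intCast_mem _ _) (prod_mem fun i _ => hM _ _)

theorem exists_eval_coord_eq_eval {m : ℕ} {M : ℂ → Matrix (Fin m) (Fin m) (PowerSeries ℂ)}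
    (hM : ∀ i j, (fun s => M s i j) ∈ polyFamily)
    (F : MvPolynomial (Fin m × Fin m × {k : ℕ // (k : ℕ∞) ≤ ⊤}) ℂ) :
    ∃ P : Polynomial ℂ, ∀ (s : ℂ) (A : SkewJet m ⊤),
      (M s).map (Ideal.Quotient.mk (jetIdeal ⊤)) = A.1 →
      MvPolynomial.eval A.coord F = P.eval s := by
  choose P hP using fun x : Fin m × Fin m × {k : ℕ // (k : ℕ∞) ≤ ⊤} =>
    exists_coeff_eq_eval (hM x.1 x.2.1) x.2.2.1
  refine ⟨MvPolynomial.aeval P F, fun s A hA => ?_⟩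
  have hco : A.coord = fun x => (P x).eval s := by
    funext x
    rw [coord_eq_coeff hA x, hP]
  rw [hco]
  induction F using MvPolynomial.induction_on with
  | C c => simp
  | add f g hf hg => simp [hf, hg]
  | mul_X f x hf => simp [hf]

theorem congr_transpose_eq_neg {m : ℕ} {M : Matrix (Fin m) (Fin m) (PowerSeries ℂ)}
    (hM : M.transpose = -M) (G : Matrix (Fin m) (Fin m) (PowerSeries ℂ)) :
    (G * M * G.transpose).transpose = -(G * M * G.transpose) := by
  rw [Matrix.transpose_mul, Matrix.transpose_mul, Matrix.transpose_transpose, hM]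
  simp [Matrix.mul_assoc]

/-- The jet given by a skew-symmetric matrix of power series. -/
noncomputable def SkewJet.ofMatrix {m : ℕ} (l : ℕ∞) (M : Matrix (Fin m) (Fin m) (PowerSeries ℂ))
    (hM : M.transpose = -M) : SkewJet m l :=
  ⟨M.map (Ideal.Quotient.mk (jetIdeal l)), by
    rw [← Matrix.transpose_map, hM]
    exact Matrix.ext fun i j => map_neg (Ideal.Quotient.mk (jetIdeal l)) _⟩

theorem SkewJet.coe_ofMatrix {m : ℕ} (l : ℕ∞) {M : Matrix (Fin m) (Fin m) (PowerSeries ℂ)}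
    (hM : M.transpose = -M) :
    (SkewJet.ofMatrix l M hM).1 = M.map (Ideal.Quotient.mk (jetIdeal l)) := rfl

theorem ofMatrix_mem_congruenceOrbit {m : ℕ} {l : ℕ∞} {a : Fin (m / 2) → ℕ∞}
    {G : Matrix (Fin m) (Fin m) (PowerSeries ℂ)} (hG : IsUnit G) :
    SkewJet.ofMatrix l _ (congr_transpose_eq_neg
      (stdSkew_transpose m fun q => tPow (a q)) G) ∈ congruenceOrbit m l a :=
  mem_congruenceOrbit_iff.2 ⟨G, hG, rfl⟩

/-- If a polynomial family of matrices is congruent to the normal form of type `a` outside `0`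
and is the normal form of type `b` at `0`, then the orbit of type `b` lies in the closure of the
orbit of type `a`. -/
theorem congruenceOrbit_subset_closure_of_family {m : ℕ} {a b : Fin (m / 2) → ℕ∞}
    (M : ℂ → Matrix (Fin m) (Fin m) (PowerSeries ℂ))
    (hM : ∀ i j, (fun s => M s i j) ∈ polyFamily)
    (h0 : M 0 = stdSkew m fun q => tPow (b q))
    (hs : ∀ s ≠ 0, ∃ G, IsUnit G ∧ M s = G * (stdSkew m fun q => tPow (a q)) * G.transpose) :
    congruenceOrbit m ⊤ b ⊆ closure (congruenceOrbit m ⊤ a) := by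
  intro B hB
  obtain ⟨H, hH, hBH⟩ := mem_congruenceOrbit_iff.1 hB
  rw [mem_closure_skewJet_iff]
  intro F hF
  have hHMH : ∀ i j, (fun s => (H * M s * H.transpose) i j) ∈ polyFamily :=
    matrix_mul_mem_polyFamily (M := fun s => H * M s) (N := fun _ => H.transpose)
      (matrix_mul_mem_polyFamily (M := fun _ => H) (fun i j => const_mem_polyFamily (H i j)) hM)
      (fun i j => const_mem_polyFamily (H.transpose i j))
  obtain ⟨P, hP⟩ := exists_eval_coord_eq_eval hHMH F
  have hroot : ∀ s ≠ 0, P.eval s = 0 := by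
    intro s hs0
    obtain ⟨G, hG, hMG⟩ := hs s hs0
    have hHM : H * M s * H.transpose =
        (H * G) * (stdSkew m fun q => tPow (a q)) * (H * G).transpose := by
      rw [hMG, Matrix.transpose_mul]
      simp only [Matrix.mul_assoc]
    rw [← hF _ (ofMatrix_mem_congruenceOrbit (hH.mul hG))]
    exact (hP s _ (by rw [hHM, SkewJet.coe_ofMatrix])).symm
  have hP0 : P = 0 := by
    have : Polynomial.X * P = 0 := Polynomial.funext fun s => by
      rcases eq_or_ne s 0 with rfl | h
      · simp
      · simp [hroot s h]
    simpa using this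
  rw [hP 0 B (by rw [h0, hBH]), hP0, Polynomial.eval_zero]

/-- Orbits of arcs are irreducible, since any two elements of `GL_m(ℂ⟦t⟧)` lie on a line that
meets the complement of `GL_m(ℂ⟦t⟧)` in finitely many points. -/
theorem isIrreducible_congruenceOrbit (m : ℕ) (a : Fin (m / 2) → ℕ∞) :
    IsIrreducible (congruenceOrbit m ⊤ a) := by
  refine ⟨⟨_, ofMatrix_mem_congruenceOrbit isUnit_one⟩, ?_⟩
  rintro U V hU hV ⟨A₁, hA₁, hA₁U⟩ ⟨A₂, hA₂, hA₂V⟩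
  obtain ⟨G₁, hG₁, hAG₁⟩ := mem_congruenceOrbit_iff.1 hA₁
  obtain ⟨G₂, hG₂, hAG₂⟩ := mem_congruenceOrbit_iff.1 hA₂
  obtain ⟨F₁, hF₁, hFU⟩ := exists_eval_ne_zero_of_mem_open hU hA₁U
  obtain ⟨F₂, hF₂, hFV⟩ := exists_eval_ne_zero_of_mem_open hV hA₂V
  let g : ℂ → Matrix (Fin m) (Fin m) (PowerSeries ℂ) := fun s =>
    PowerSeries.C (1 - s) • G₁ + PowerSeries.C s • G₂
  have g0 : g 0 = G₁ := by simp [g]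
  have g1 : g 1 = G₂ := by simp [g]
  have hg : ∀ i j, (fun s => g s i j) ∈ polyFamily := by
    intro i j
    have h : (fun s => g s i j) = (1 - fun s => PowerSeries.C s) * (fun _ => G₁ i j) +
        (fun s => PowerSeries.C s) * (fun _ => G₂ i j) := by
      funext s
      simp [g]
    rw [h]
    exact add_mem (mul_mem (sub_mem (one_mem _) C_mem_polyFamily) (const_mem_polyFamily _))
      (mul_mem C_mem_polyFamily (const_mem_polyFamily _))
  have hM : ∀ i j, (fun s => (g s * (stdSkew m fun q => tPow (a q)) * (g s).transpose) i j) ∈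
      polyFamily :=
    matrix_mul_mem_polyFamily (M := fun s => g s * stdSkew m fun q => tPow (a q))
      (N := fun s => (g s).transpose)
      (matrix_mul_mem_polyFamily (N := fun _ => stdSkew m fun q => tPow (a q)) hg
        (fun i j => const_mem_polyFamily _)) (fun i j => hg j i)
  obtain ⟨P₁, hP₁⟩ := exists_eval_coord_eq_eval hM F₁
  obtain ⟨P₂, hP₂⟩ := exists_eval_coord_eq_eval hM F₂
  obtain ⟨D, hD⟩ := exists_coeff_eq_eval (det_mem_polyFamily hg) 0
  have hunit : ∀ s, IsUnit (g s) ↔ D.eval s ≠ 0 := by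
    intro s
    rw [Matrix.isUnit_iff_isUnit_det, PowerSeries.isUnit_iff_constantCoeff, isUnit_iff_ne_zero,
      ← PowerSeries.coeff_zero_eq_constantCoeff_apply, hD]
  have n1 : P₁ ≠ 0 := by
    rintro rfl
    rw [hP₁ 0 A₁ (by rw [g0, hAG₁])] at hF₁
    simp at hF₁
  have n2 : P₂ ≠ 0 := by
    rintro rfl
    rw [hP₂ 1 A₂ (by rw [g1, hAG₂])] at hF₂
    simp at hF₂
  have n3 : D ≠ 0 := by
    rintro rfl
    have := (hunit 0).1 (g0 ▸ hG₁)
    simp at this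
  obtain ⟨s, hs⟩ : ∃ s, (P₁ * P₂ * D).eval s ≠ 0 := by
    by_contra! h
    exact mul_ne_zero (mul_ne_zero n1 n2) n3 (Polynomial.funext fun s => by simpa using h s)
  rw [Polynomial.eval_mul, Polynomial.eval_mul] at hs
  have hsD := right_ne_zero_of_mul hs
  have hs1 := left_ne_zero_of_mul (left_ne_zero_of_mul hs)
  have hs2 := right_ne_zero_of_mul (left_ne_zero_of_mul hs)
  refine ⟨_, ofMatrix_mem_congruenceOrbit ((hunit s).2 hsD), hFU _ ?_, hFV _ ?_⟩
  · rwa [hP₁ s _ (SkewJet.coe_ofMatrix _ _).symm]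
  · rwa [hP₂ s _ (SkewJet.coe_ofMatrix _ _).symm]

/-! ### Degenerations of orbits of arcs -/

theorem partialSum_le_of_subset_closure {m : ℕ} {a b : Fin (m / 2) → ℕ∞}
    (ha : Monotone a) (hb : Monotone b)
    (h : congruenceOrbit m ⊤ b ⊆ closure (congruenceOrbit m ⊤ a)) {k : ℕ} (hk : k ≤ m / 2) :
    partialSum a k ≤ partialSum b k := by
  have hB := h (ofMatrix_mem_congruenceOrbit isUnit_one)
  rw [← pfaffianOrderGE_congr_iff hk hb isUnit_one]
  refine PfaffianOrderGE.of_mem_closure hB rfl fun A hA => ?_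
  obtain ⟨G, hG, hGA⟩ := mem_congruenceOrbit_iff.1 hA
  exact ⟨_, hGA.symm, (pfaffianOrderGE_congr_iff hk ha hG).2 le_rfl⟩

theorem stdSkew_eq_sum {R : Type*} [CommRing R] {m : ℕ} (c : Fin (m / 2) → R) (i j : Fin m) :
    stdSkew m c i j = ∑ q : Fin (m / 2), c q *
      ((1 : Matrix (Fin m) (Fin m) R) i (pairFst (Nat.mul_div_le m 2) q) *
          (1 : Matrix (Fin m) (Fin m) R) j (pairSnd (Nat.mul_div_le m 2) q) -
        (1 : Matrix (Fin m) (Fin m) R) i (pairSnd (Nat.mul_div_le m 2) q) *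
          (1 : Matrix (Fin m) (Fin m) R) j (pairFst (Nat.mul_div_le m 2) q)) := by
  rw [← mul_stdSkew_mul_transpose_apply]
  simp

theorem stdSkew_mem_polyFamily {m : ℕ} {c : ℂ → Fin (m / 2) → PowerSeries ℂ}
    (hc : ∀ q, (fun s => c s q) ∈ polyFamily) (i j : Fin m) :
    (fun s => stdSkew m (c s) i j) ∈ polyFamily := by
  have h : (fun s => stdSkew m (c s) i j) = ∑ q : Fin (m / 2), (fun s => c s q) * fun _ =>
      ((1 : Matrix (Fin m) (Fin m) (PowerSeries ℂ)) i (pairFst (Nat.mul_div_le m 2) q) *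
          (1 : Matrix (Fin m) (Fin m) (PowerSeries ℂ)) j (pairSnd (Nat.mul_div_le m 2) q) -
        (1 : Matrix (Fin m) (Fin m) (PowerSeries ℂ)) i (pairSnd (Nat.mul_div_le m 2) q) *
          (1 : Matrix (Fin m) (Fin m) (PowerSeries ℂ)) j (pairFst (Nat.mul_div_le m 2) q)) := by
    funext s
    rw [stdSkew_eq_sum]
    simp
  rw [h]
  exact sum_mem fun q _ => mul_mem (hc q) (const_mem_polyFamily _)

/-- Multiplying the blocks of a block diagonal matrix by units is a congruence. -/
theorem exists_stdSkew_mul_units {R : Type*} [CommRing R] {m : ℕ} (c : Fin (m / 2) → R)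
    {u : Fin (m / 2) → R} (hu : ∀ q, IsUnit (u q)) :
    ∃ G : Matrix (Fin m) (Fin m) R, IsUnit G ∧
      stdSkew m (fun q => c q * u q) = G * stdSkew m c * G.transpose := by
  let d : Fin m → R := fun v => if h : v.1 % 2 = 0 ∧ v.1 / 2 < m / 2 then u ⟨v.1 / 2, h.2⟩ else 1
  have hd : ∀ v, IsUnit (d v) := by
    intro v
    simp only [d]
    split_ifs
    exacts [hu _, isUnit_one]
  have hd0 : ∀ q, d (pairFst (Nat.mul_div_le m 2) q) = u q := by
    intro q
    simp [d, pairFst]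
  have hd1 : ∀ q, d (pairSnd (Nat.mul_div_le m 2) q) = 1 := by
    intro q
    simp [d, pairSnd]
  have hG : ∀ i v, Matrix.diagonal d i v = d v * (1 : Matrix (Fin m) (Fin m) R) i v := by
    intro i v
    rw [Matrix.diagonal_apply, Matrix.one_apply]
    split_ifs with h
    · rw [h, mul_one]
    · rw [mul_zero]
  refine ⟨Matrix.diagonal d, ?_, ?_⟩
  · rw [Matrix.isUnit_iff_isUnit_det, Matrix.det_diagonal]
    exact IsUnit.prod_univ_iff.2 hd
  · refine Matrix.ext fun i j => ?_
    rw [mul_stdSkew_mul_transpose_apply, stdSkew_eq_sum]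
    refine Finset.sum_congr rfl fun q _ => ?_
    simp only [hG, hd0, hd1]
    ring

/-- Raising exponents is a degeneration, along `s t ^ a + (1 - s) t ^ b`. -/
theorem congruenceOrbit_subset_closure_of_le {m : ℕ} {a b : Fin (m / 2) → ℕ∞} (hab : a ≤ b) :
    congruenceOrbit m ⊤ b ⊆ closure (congruenceOrbit m ⊤ a) := by
  choose c hc using fun q => exists_add_of_le (hab q)
  let u : ℂ → Fin (m / 2) → PowerSeries ℂ := fun s q =>
    PowerSeries.C s + (1 - PowerSeries.C s) * tPow (c q)
  refine congruenceOrbit_subset_closure_of_family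
    (fun s => stdSkew m fun q => tPow (a q) * u s q) (fun i j => stdSkew_mem_polyFamily ?_ i j)
    ?_ ?_
  · intro q
    exact mul_mem (const_mem_polyFamily _) (add_mem C_mem_polyFamily
      (mul_mem (sub_mem (one_mem _) C_mem_polyFamily) (const_mem_polyFamily _)))
  · congr 1
    funext q
    simp [u, hc, tPow_add]
  · intro s hs
    refine exists_stdSkew_mul_units _ fun q => ?_
    rcases eq_or_ne (c q) 0 with h | h
    · simp [u, h, tPow_zero]
    · have h1 : PowerSeries.constantCoeff (tPow (c q)) = 0 := by
        rw [← PowerSeries.coeff_zero_eq_constantCoeff_apply]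
        exact tPow_dvd_iff.1 dvd_rfl 0 (by simpa using pos_iff_ne_zero.2 h)
      rw [PowerSeries.isUnit_iff_constantCoeff]
      simp [u, h1, hs]

/-- Moving one unit from a larger to a smaller exponent is a degeneration, along the family
obtained by adding `s t ^ x` in the first rows of the two blocks. -/
theorem congruenceOrbit_subset_closure_of_transfer {m : ℕ} {a b : Fin (m / 2) → ℕ∞}
    {p q : Fin (m / 2)} (hpq : p ≠ q) {x d : ℕ} (hap : a p = x) (haq : a q = (x + d + 1 : ℕ))
    (hbp : b p = (x + 1 : ℕ)) (hbq : b q = (x + d : ℕ)) (hr : ∀ r, r ≠ p → r ≠ q → b r = a r) :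
    congruenceOrbit m ⊤ b ⊆ closure (congruenceOrbit m ⊤ a) := by
  let fst := pairFst (Nat.mul_div_le m 2)
  let snd := pairSnd (Nat.mul_div_le m 2)
  let δ : Fin m → Fin m → PowerSeries ℂ := fun i j => (1 : Matrix (Fin m) (Fin m) _) i j
  let T : PowerSeries ℂ := PowerSeries.X
  refine congruenceOrbit_subset_closure_of_family
    (fun s => Matrix.of fun i j => stdSkew m (fun q => tPow (b q)) i j + PowerSeries.C s *
      (T ^ x * (δ i (fst p) * δ j (fst q) - δ i (fst q) * δ j (fst p)))) ?_ ?_ ?_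
  · intro i j
    exact add_mem (const_mem_polyFamily _) (mul_mem C_mem_polyFamily (const_mem_polyFamily _))
  · refine Matrix.ext fun i j => ?_
    simp
  intro s hs
  have hss : PowerSeries.C s * PowerSeries.C s⁻¹ = (1 : PowerSeries ℂ) := by
    rw [← map_mul, mul_inv_cancel₀ hs, map_one]
  -- For the basis vectors `e, e'` and `f, f'` of the two blocks, the columns are the vectors in
  -- `t ^ x • e ∧ (s f + t e') + t ^ (x + d) • f ∧ f' =
  --   t ^ x • (e - s⁻¹ t ^ d f') ∧ (s f + t e') + t ^ (x + d + 1) • (-s⁻¹ e') ∧ f'`.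
  let G : Matrix (Fin m) (Fin m) (PowerSeries ℂ) := Matrix.of fun i v =>
    if v = fst p then δ i (fst p) - PowerSeries.C s⁻¹ * T ^ d * δ i (snd q)
    else if v = snd p then PowerSeries.C s * δ i (fst q) + T * δ i (snd p)
    else if v = fst q then -PowerSeries.C s⁻¹ * δ i (snd p)
    else δ i v
  have G1 : ∀ i, G i (fst p) = δ i (fst p) - PowerSeries.C s⁻¹ * T ^ d * δ i (snd q) := by
    intro i; simp [G]
  have G2 : ∀ i, G i (snd p) = PowerSeries.C s * δ i (fst q) + T * δ i (snd p) := by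
    intro i; simp [G, fst, snd]
  have G3 : ∀ i, G i (fst q) = -PowerSeries.C s⁻¹ * δ i (snd p) := by
    intro i; simp [G, fst, snd, hpq.symm]
  have G4 : ∀ i v, v ≠ fst p → v ≠ snd p → v ≠ fst q → G i v = δ i v := by
    intro i v h1 h2 h3; simp [G, h1, h2, h3]
  have G5 : ∀ i, G i (snd q) = δ i (snd q) := fun i =>
    G4 i _ (by simp [fst, snd]) (by simp [snd, hpq.symm]) (by simp [fst, snd])
  refine ⟨G, ?_, ?_⟩
  · -- the standard basis lies in the span of the columns of `G`
    rw [← Matrix.mulVec_surjective_iff_isUnit]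
    change Function.Surjective (Matrix.mulVecLin G)
    rw [← LinearMap.range_eq_top]
    set W := LinearMap.range (Matrix.mulVecLin G) with hW
    have hcol : ∀ v, (fun i => G i v) ∈ W := by
      intro v
      refine ⟨Pi.single v 1, ?_⟩
      rw [Matrix.mulVecLin_apply, Matrix.mulVec_single_one]
      rfl
    have e4 : (fun i => δ i (snd q)) ∈ W := by
      simpa only [G5] using hcol (snd q)
    have e2 : (fun i => δ i (snd p)) ∈ W := by
      have h := W.smul_mem (-PowerSeries.C s) (hcol (fst q))
      convert h using 1
      funext i
      simp only [G3, Pi.smul_apply, smul_eq_mul]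
      linear_combination (-δ i (snd p)) * hss
    have e1 : (fun i => δ i (fst p)) ∈ W := by
      have h := W.add_mem (hcol (fst p)) (W.smul_mem (PowerSeries.C s⁻¹ * T ^ d) e4)
      convert h using 1
      funext i
      simp only [G1, Pi.smul_apply, Pi.add_apply, smul_eq_mul]
      ring
    have e3 : (fun i => δ i (fst q)) ∈ W := by
      have h := W.smul_mem (PowerSeries.C s⁻¹) (W.sub_mem (hcol (snd p)) (W.smul_mem T e2))
      convert h using 1
      funext i
      simp only [G2, Pi.smul_apply, Pi.sub_apply, smul_eq_mul]
      linear_combination (-δ i (fst q)) * hss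
    have hall : ∀ v, (fun i => δ i v) ∈ W := by
      intro v
      by_cases h1 : v = fst p
      · rwa [h1]
      by_cases h2 : v = snd p
      · rwa [h2]
      by_cases h3 : v = fst q
      · rwa [h3]
      simpa only [G4 _ v h1 h2 h3] using hcol v
    refine eq_top_iff.2 fun y _ => ?_
    have hy : y = ∑ v, y v • (fun i => δ i v) := by
      funext i
      simp [δ, Matrix.one_apply]
    rw [hy]
    exact sum_mem fun v _ => W.smul_mem _ (hall v)
  · refine Matrix.ext fun i j => ?_
    rw [Matrix.of_apply, mul_stdSkew_mul_transpose_apply, stdSkew_eq_sum]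
    have hq : q ∈ Finset.univ.erase p := by simp [hpq.symm]
    rw [← Finset.add_sum_erase _ _ (Finset.mem_univ p), ← Finset.add_sum_erase _ _ hq,
      ← Finset.add_sum_erase _ _ (Finset.mem_univ p), ← Finset.add_sum_erase _ _ hq]
    have hrest : ∀ r ∈ (Finset.univ.erase p).erase q, tPow (b r) *
        (δ i (fst r) * δ j (snd r) - δ i (snd r) * δ j (fst r)) =
        tPow (a r) * (G i (fst r) * G j (snd r) - G i (snd r) * G j (fst r)) := by
      intro r hr'
      have hrq : r ≠ q := (Finset.mem_erase.1 hr').1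
      have hrp : r ≠ p := (Finset.mem_erase.1 (Finset.mem_erase.1 hr').2).1
      have g1 : ∀ i, G i (fst r) = δ i (fst r) := fun i =>
        G4 i _ (by simpa [fst] using hrp) (by simp [fst, snd]) (by simpa [fst] using hrq)
      have g2 : ∀ i, G i (snd r) = δ i (snd r) := fun i =>
        G4 i _ (by simp [fst, snd]) (by simpa [snd] using hrp) (by simp [fst, snd])
      rw [hr r hrp hrq, g1, g1, g2, g2]
    have hrest' := Finset.sum_congr rfl hrest
    simp only [δ, fst, snd] at hrest' G1 G2 G3 G5 ⊢
    rw [hrest', G1, G1, G2, G2, G3, G3, G5, G5, hap, haq, hbp, hbq]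
    simp only [tPow_coe, pow_succ, pow_add, T]
    linear_combination (-PowerSeries.X ^ x * PowerSeries.X ^ d *
      ((1 : Matrix (Fin m) (Fin m) (PowerSeries ℂ)) i (pairFst (Nat.mul_div_le m 2) q) *
        (1 : Matrix (Fin m) (Fin m) (PowerSeries ℂ)) j (pairSnd (Nat.mul_div_le m 2) q) -
      (1 : Matrix (Fin m) (Fin m) (PowerSeries ℂ)) i (pairSnd (Nat.mul_div_le m 2) q) *
        (1 : Matrix (Fin m) (Fin m) (PowerSeries ℂ)) j (pairFst (Nat.mul_div_le m 2) q))) * hss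

/-! ### The dominance order -/

theorem sum_range_update (a : ℕ → ℕ) (i v k : ℕ) :
    ∑ x ∈ Finset.range k, Function.update a i v x + (if i < k then a i else 0) =
      ∑ x ∈ Finset.range k, a x + (if i < k then v else 0) := by
  induction k with
  | zero => simp
  | succ k ih =>
    rw [Finset.sum_range_succ, Finset.sum_range_succ]
    rcases lt_trichotomy i k with h | rfl | h
    · rw [Function.update_of_ne h.ne']
      simp only [h, h.trans (Nat.lt_succ_self k), if_true] at ih ⊢
      omega
    · rw [Function.update_self]
      simp only [lt_irrefl, if_false, Nat.lt_succ_self, if_true] at ih ⊢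
      omega
    · rw [Function.update_of_ne h.ne]
      simp only [h.not_gt, show ¬ i < k + 1 by omega, if_false] at ih ⊢
      omega

/-- A sequence `a` dominated by a nondecreasing sequence `b` in the order of partial sums is
turned into `b` by finitely many moves, each of which raises an entry by one or transfers one
unit from an entry to an earlier entry that is smaller by at least two. All intermediate
sequences are dominated by `b`. -/
theorem dominance_induction {r : ℕ} {b : ℕ → ℕ} (hb : ∀ i j, i ≤ j → j < r → b i ≤ b j)
    {P : (ℕ → ℕ) → Prop} (base : ∀ a, (∀ i < r, a i = b i) → P a)
    (raise : ∀ a i, i < r → P (Function.update a i (a i + 1)) → P a)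
    (transfer : ∀ a i j, i < j → j < r → a i + 2 ≤ a j →
      P (Function.update (Function.update a i (a i + 1)) j (a j - 1)) → P a) :
    ∀ a : ℕ → ℕ, (∀ k ≤ r, ∑ x ∈ Finset.range k, a x ≤ ∑ x ∈ Finset.range k, b x) → P a := by
  intro a
  induction hN : ∑ k ∈ Finset.range (r + 1),
    (∑ x ∈ Finset.range k, b x - ∑ x ∈ Finset.range k, a x)
    using Nat.strong_induction_on generalizing a with
  | _ N ih =>
  intro hab
  by_cases heq : ∀ i < r, a i = b i
  · exact base a heq
  -- the first entry at which the sequences differ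
  obtain ⟨i, ⟨hir, hi⟩, hmin⟩ : ∃ i, (i < r ∧ a i ≠ b i) ∧ ∀ x < i, ¬ (x < r ∧ a x ≠ b x) := by
    push Not at heq
    exact ⟨Nat.find heq, Nat.find_spec heq, fun x hx => Nat.find_min heq hx⟩
  have hSi : ∑ x ∈ Finset.range i, a x = ∑ x ∈ Finset.range i, b x := by
    refine Finset.sum_congr rfl fun x hx => ?_
    have hx' := Finset.mem_range.1 hx
    by_contra hne
    exact hmin x hx' ⟨hx'.trans hir, hne⟩
  have hSi1 := hab (i + 1) hir
  rw [Finset.sum_range_succ, Finset.sum_range_succ, hSi] at hSi1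
  have hlt : a i < b i := by omega
  have step : ∀ a' : ℕ → ℕ,
      (∀ k ≤ r, ∑ x ∈ Finset.range k, a x ≤ ∑ x ∈ Finset.range k, a' x ∧
        ∑ x ∈ Finset.range k, a' x ≤ ∑ x ∈ Finset.range k, b x) →
      ∑ x ∈ Finset.range (i + 1), a x < ∑ x ∈ Finset.range (i + 1), a' x → P a' := by
    intro a' ha' hlt'
    refine ih _ ?_ a' rfl fun k hk => (ha' k hk).2
    rw [← hN]
    refine Finset.sum_lt_sum (fun k hk => ?_) ⟨i + 1, by simpa using hir, ?_⟩
    · have := ha' k (by simpa [Nat.lt_succ_iff] using hk)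
      omega
    · have := ha' (i + 1) hir
      omega
  by_cases hj : ∃ j, i < j ∧ j < r ∧
      ∑ x ∈ Finset.range (j + 1), a x = ∑ x ∈ Finset.range (j + 1), b x
  · -- the first later place where the partial sums agree again
    obtain ⟨j, ⟨hij, hjr, hSj⟩, hjmin⟩ : ∃ j, (i < j ∧ j < r ∧
        ∑ x ∈ Finset.range (j + 1), a x = ∑ x ∈ Finset.range (j + 1), b x) ∧
        ∀ x < j, ¬ (i < x ∧ x < r ∧
          ∑ y ∈ Finset.range (x + 1), a y = ∑ y ∈ Finset.range (x + 1), b y) :=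
      ⟨Nat.find hj, Nat.find_spec hj, fun x hx => Nat.find_min hj hx⟩
    have hstrict : ∀ k, i < k → k ≤ j →
        ∑ x ∈ Finset.range k, a x < ∑ x ∈ Finset.range k, b x := by
      intro k hik hkj
      refine lt_of_le_of_ne (hab k (by omega)) fun h => ?_
      obtain ⟨k, rfl⟩ : ∃ k', k = k' + 1 := ⟨k - 1, by omega⟩
      rcases (Nat.lt_succ_iff.1 hik).eq_or_lt with rfl | hik'
      · rw [Finset.sum_range_succ, Finset.sum_range_succ] at h
        omega
      · exact hjmin k (by omega) ⟨hik', by omega, h⟩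
    have haj : b j < a j := by
      have h1 := hstrict j hij le_rfl
      rw [Finset.sum_range_succ, Finset.sum_range_succ] at hSj
      omega
    have hbij := hb i j hij.le hjr
    refine transfer a i j hij hjr (by omega) (step _ (fun k hk => ?_) ?_)
    · have h1 := sum_range_update (Function.update a i (a i + 1)) j (a j - 1) k
      have h2 := sum_range_update a i (a i + 1) k
      rw [Function.update_of_ne hij.ne'] at h1
      have h3 := hab k hk
      have h4 := hstrict k
      split_ifs at h1 h2 <;> omega
    · have h1 := sum_range_update (Function.update a i (a i + 1)) j (a j - 1) (i + 1)
      have h2 := sum_range_update a i (a i + 1) (i + 1)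
      rw [if_neg (by omega), if_neg (by omega)] at h1
      rw [if_pos (by omega), if_pos (by omega)] at h2
      omega
  · push Not at hj
    refine raise a i hir (step _ (fun k hk => ?_) ?_)
    · have h2 := sum_range_update a i (a i + 1) k
      have h3 := hab k hk
      have h4 : i < k → ∑ x ∈ Finset.range k, a x ≠ ∑ x ∈ Finset.range k, b x := by
        intro hik h
        obtain ⟨k, rfl⟩ : ∃ k', k = k' + 1 := ⟨k - 1, by omega⟩
        rcases (Nat.lt_succ_iff.1 hik).eq_or_lt with rfl | hik'
        · rw [Finset.sum_range_succ, Finset.sum_range_succ] at h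
          omega
        · exact hj k hik' (by omega) h
      split_ifs at h2 <;> omega
    · have h2 := sum_range_update a i (a i + 1) (i + 1)
      rw [if_pos (by omega), if_pos (by omega)] at h2
      omega

/-- The sequence of length `n` that agrees with `a` at the first `r` places and is infinite
from there on. -/
def extendTop (n r : ℕ) (a : ℕ → ℕ) : Fin n → ℕ∞ := fun q => if q.1 < r then (a q.1 : ℕ∞) else ⊤

theorem partialSum_eq_natCast {n k : ℕ} (hk : k ≤ n) {c : Fin n → ℕ∞} {a : ℕ → ℕ}
    (h : ∀ i (hi : i < n), i < k → c ⟨i, hi⟩ = a i) :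
    partialSum c k = (∑ x ∈ Finset.range k, a x : ℕ) := by
  induction k with
  | zero => simp [partialSum_zero]
  | succ k ih =>
    rw [partialSum_succ c hk, ih (Nat.le_of_succ_le hk) fun i hi hik => h i hi (by omega),
      h k hk (Nat.lt_succ_self k), Finset.sum_range_succ]
    push_cast
    rfl

theorem le_partialSum {n k : ℕ} (a : Fin n → ℕ∞) {i : Fin n} (hi : i.1 < k) :
    a i ≤ partialSum a k :=
  Finset.single_le_sum (f := a) (fun _ _ => bot_le) (by simpa using hi)

theorem congruenceOrbit_subset_closure_trans {m : ℕ} {a b c : Fin (m / 2) → ℕ∞}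
    (hab : congruenceOrbit m ⊤ b ⊆ closure (congruenceOrbit m ⊤ a))
    (hbc : congruenceOrbit m ⊤ c ⊆ closure (congruenceOrbit m ⊤ b)) :
    congruenceOrbit m ⊤ c ⊆ closure (congruenceOrbit m ⊤ a) :=
  hbc.trans (closure_minimal hab isClosed_closure)

theorem congruenceOrbit_subset_closure_of_partialSum_le {m : ℕ} {a b : Fin (m / 2) → ℕ∞}
    (hb : Monotone b) (h : ∀ k ≤ m / 2, partialSum a k ≤ partialSum b k) :
    congruenceOrbit m ⊤ b ⊆ closure (congruenceOrbit m ⊤ a) := by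
  -- the number of finite entries of `b`
  obtain ⟨r, hr, hrmin⟩ : ∃ r, (∀ h : r < m / 2, b ⟨r, h⟩ = ⊤) ∧
      ∀ x < r, ¬ ∀ h : x < m / 2, b ⟨x, h⟩ = ⊤ := by
    have hex : ∃ r, ∀ h : r < m / 2, b ⟨r, h⟩ = ⊤ := ⟨m / 2, fun h => absurd h (lt_irrefl _)⟩
    classical
    exact ⟨Nat.find hex, Nat.find_spec hex, fun x hx => Nat.find_min hex hx⟩
  have hrm : r ≤ m / 2 := by
    by_contra! hlt
    exact hrmin _ hlt fun h => absurd h (lt_irrefl _)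
  have hfin : ∀ i (hi : i < m / 2), i < r → b ⟨i, hi⟩ ≠ ⊤ := fun i hi hir htop =>
    hrmin i hir fun _ => htop
  have hinf : ∀ i (hi : i < m / 2), r ≤ i → b ⟨i, hi⟩ = ⊤ := fun i hi hri =>
    top_le_iff.1 ((hr (hri.trans_lt hi)).ge.trans (hb hri))
  have hbr : partialSum b r ≠ ⊤ := by
    rw [partialSum_eq_sum b hrm, Ne, ENat.sum_eq_top]
    rintro ⟨i, -, hi⟩
    exact hfin i.1 (i.2.trans_le hrm) i.2 hi
  have hafin : ∀ i (hi : i < m / 2), i < r → a ⟨i, hi⟩ ≠ ⊤ := fun i hi hir htop => by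
    have h1 := (le_partialSum a (i := ⟨i, hi⟩) hir).trans (h r hrm)
    rw [htop, top_le_iff] at h1
    exact hbr h1
  let A : ℕ → ℕ := fun i => if hi : i < m / 2 then (a ⟨i, hi⟩).toNat else 0
  let B : ℕ → ℕ := fun i => if hi : i < m / 2 then (b ⟨i, hi⟩).toNat else 0
  have hA : ∀ i (hi : i < m / 2), i < r → a ⟨i, hi⟩ = A i := fun i hi hir => by
    simp only [A, hi, dif_pos]
    exact (ENat.natCast_toNat (hafin i hi hir)).symm
  have hB : ∀ i (hi : i < m / 2), i < r → b ⟨i, hi⟩ = B i := fun i hi hir => by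
    simp only [B, hi, dif_pos]
    exact (ENat.natCast_toNat (hfin i hi hir)).symm
  have hle : a ≤ extendTop (m / 2) r A := by
    intro q
    rw [extendTop]
    split_ifs with hq
    · exact (hA q.1 q.2 hq).le
    · exact le_top
  refine congruenceOrbit_subset_closure_trans (congruenceOrbit_subset_closure_of_le hle) ?_
  refine dominance_induction (r := r) (b := B)
    (P := fun a => congruenceOrbit m ⊤ b ⊆ closure (congruenceOrbit m ⊤ (extendTop (m / 2) r a)))
    ?_ ?_ ?_ ?_ A ?_
  · intro i j hij hjr
    have hjm : j < m / 2 := hjr.trans_le hrm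
    have h1 : b ⟨i, hij.trans_lt hjm⟩ ≤ b ⟨j, hjm⟩ := hb hij
    rw [hB i _ (hij.trans_lt hjr), hB j _ hjr] at h1
    exact_mod_cast h1
  · intro c hc
    have : extendTop (m / 2) r c = b := by
      funext q
      rw [extendTop]
      split_ifs with hq
      · rw [hc _ hq, ← hB q.1 q.2 hq]
      · exact (hinf q.1 q.2 (not_lt.1 hq)).symm
    rw [this]
    exact subset_closure
  · intro c i _ hPi
    refine congruenceOrbit_subset_closure_trans (congruenceOrbit_subset_closure_of_le ?_) hPi
    intro q
    rw [extendTop, extendTop]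
    split_ifs with hq
    · rcases eq_or_ne q.1 i with hqi | hqi
      · rw [hqi, Function.update_self]
        exact Nat.cast_le.2 (Nat.le_succ _)
      · rw [Function.update_of_ne hqi]
    · exact le_rfl
  · intro c i j hij hjr hcij hPij
    refine congruenceOrbit_subset_closure_trans
      (congruenceOrbit_subset_closure_of_transfer (p := ⟨i, by omega⟩) (q := ⟨j, by omega⟩)
        (x := c i) (d := c j - c i - 1) (by simp [hij.ne]) ?_ ?_ ?_ ?_ ?_) hPij
    · simp [extendTop, hij.trans hjr]
    · simp only [extendTop, hjr, if_true]
      congr 1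
      omega
    · simp [extendTop, hij.trans hjr, Function.update_of_ne hij.ne]
    · simp only [extendTop, hjr, if_true, Function.update_self]
      congr 1
      omega
    · intro q hqi hqj
      have h1 : q.1 ≠ i := fun h => hqi (Fin.ext h)
      have h2 : q.1 ≠ j := fun h => hqj (Fin.ext h)
      rw [extendTop, extendTop, Function.update_of_ne h2, Function.update_of_ne h1]
  · intro k hk
    have h1 := h k (hk.trans hrm)
    rw [partialSum_eq_natCast (hk.trans hrm) fun i hi hik => hA i hi (hik.trans_le hk),
      partialSum_eq_natCast (hk.trans hrm) fun i hi hik => hB i hi (hik.trans_le hk)] at h1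
    exact_mod_cast h1

theorem congruenceOrbit_subset_closure_iff {m : ℕ} {a b : Fin (m / 2) → ℕ∞} (ha : Monotone a)
    (hb : Monotone b) : congruenceOrbit m ⊤ b ⊆ closure (congruenceOrbit m ⊤ a) ↔
      ∀ k ≤ m / 2, partialSum a k ≤ partialSum b k :=
  ⟨fun h _ hk => partialSum_le_of_subset_closure ha hb h hk,
    congruenceOrbit_subset_closure_of_partialSum_le hb⟩

/-! ### Minimal sequences in the dominance order -/

/-- The sequence `(0, …, 0, p - k ⌊p / k⌋, k, …, k)` of length `n`. -/
def starSeq (n m0 p k : ℕ) : Fin n → ℕ∞ := fun i =>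
  if m0 < i.1 + 1 + p / k then (k : ℕ∞)
  else if i.1 + 1 + p / k = m0 then ((p - k * (p / k) : ℕ) : ℕ∞) else 0

/-- The partial sums of `starSeq`: among the nondecreasing sequences with `m0`-th partial sum `p`
and `m0`-th entry `k` these are the least possible ones. -/
def starSum (m0 p k j : ℕ) : ℕ := if j ≤ m0 then p - k * (m0 - j) else p + k * (j - m0)

theorem starSum_self (m0 p k : ℕ) : starSum m0 p k m0 = p := by
  simp [starSum]

theorem partialSum_starSeq {n m0 p k : ℕ} (hp : p ≤ m0 * k) {j : ℕ}
    (hj : j ≤ n) : partialSum (starSeq n m0 p k) j = starSum m0 p k j := by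
  induction j with
  | zero =>
    rw [partialSum_zero, starSum, if_pos (Nat.zero_le _), Nat.sub_zero, mul_comm,
      Nat.sub_eq_zero_of_le hp]
    rfl
  | succ j ih =>
    rw [partialSum_succ _ hj, ih (Nat.le_of_succ_le hj), starSeq]
    have hdiv : k * (p / k) ≤ p := Nat.mul_div_le p k
    have hdiv' : p ≤ k * (p / k + 1) := by
      rcases Nat.eq_zero_or_pos k with rfl | hk
      · simpa using hp
      · exact (Nat.lt_mul_div_succ p hk).le
    dsimp only
    generalize p / k = d at *
    split_ifs with h1 h2
    · norm_cast
      simp only [starSum]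
      rcases lt_or_ge j m0 with hjm | hjm
      · obtain ⟨e, rfl⟩ : ∃ e, m0 = j + 1 + e := ⟨m0 - (j + 1), by omega⟩
        have h3 : k * (e + 1) ≤ p := (Nat.mul_le_mul_left k (by omega)).trans hdiv
        rw [if_pos (by omega), if_pos (by omega), show j + 1 + e - j = e + 1 by omega,
          Nat.add_sub_cancel_left]
        rw [Nat.mul_succ] at h3 ⊢
        omega
      · obtain ⟨e, rfl⟩ : ∃ e, j = m0 + e := ⟨j - m0, by omega⟩
        rw [if_neg (by omega : ¬ m0 + e + 1 ≤ m0), show m0 + e + 1 - m0 = e + 1 by omega,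
          Nat.mul_succ]
        rcases Nat.eq_zero_or_pos e with rfl | he
        · simp
        · rw [if_neg (by omega), Nat.add_sub_cancel_left]
          omega
    · norm_cast
      simp only [starSum]
      rw [if_pos (by omega), if_pos (by omega), show m0 - j = d + 1 by omega,
        show m0 - (j + 1) = d by omega, Nat.sub_eq_zero_of_le hdiv', zero_add]
    · simp only [starSum]
      have h3 : k * (d + 1) ≤ k * (m0 - (j + 1)) := Nat.mul_le_mul_left k (by omega)
      have h4 : k * (m0 - (j + 1)) ≤ k * (m0 - j) := Nat.mul_le_mul_left k (by omega)
      rw [if_pos (by omega), if_pos (by omega), Nat.sub_eq_zero_of_le (by omega),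
        Nat.sub_eq_zero_of_le (by omega)]
      rfl

theorem monotone_starSeq {n m0 p k : ℕ} (hp : p ≤ m0 * k) : Monotone (starSeq n m0 p k) := by
  intro i j hij
  have hij' : i.1 ≤ j.1 := hij
  have hmod : p - k * (p / k) ≤ k := by
    rcases Nat.eq_zero_or_pos k with rfl | hk
    · simpa using hp
    · have := Nat.lt_mul_div_succ p hk
      rw [Nat.mul_succ] at this
      omega
  simp only [starSeq]
  split_ifs with h1 h2 h3 h4 h5 h6 h7
  all_goals first
    | exact le_rfl
    | exact bot_le
    | exact Nat.cast_le.2 hmod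
    | (exfalso; omega)

theorem mem_lambdaStar_iff {n m0 p : ℕ} (hm0 : m0 ≤ n) {a : Fin n → ℕ∞} :
    a ∈ LambdaStar n m0 p ⊤ ↔
      ∃ k, p ≤ m0 * k ∧ k ≤ p ∧ (m0 = n → k = p) ∧ a = starSeq n m0 p k := by
  constructor
  · rintro ⟨-, k, h1, h2, h3, h4, h5, h6⟩
    refine ⟨k, h1, h2, h3, ?_⟩
    funext i
    rw [starSeq]
    split_ifs with h7 h8
    exacts [h4 i h7, h5 i h8, h6 i (by omega)]
  · rintro ⟨k, h1, h2, h3, rfl⟩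
    refine ⟨⟨⟨monotone_starSeq h1, fun _ => le_top⟩, ?_⟩, k, h1, h2, h3, ?_, ?_, ?_⟩
    · rw [partialSum_starSeq h1 hm0, starSum_self]
    · intro i hi
      rw [starSeq, if_pos hi]
    · intro i hi
      rw [starSeq, if_neg (by omega), if_pos hi]
    · intro i hi
      rw [starSeq, if_neg (by omega), if_neg (by omega)]

theorem finite_lambdaStar {n m0 : ℕ} (hm0 : m0 ≤ n) (p : ℕ) : (LambdaStar n m0 p ⊤).Finite := by
  refine ((Set.finite_Iic p).image (starSeq n m0 p)).subset fun a ha => ?_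
  obtain ⟨k, -, hk, -, rfl⟩ := (mem_lambdaStar_iff hm0).1 ha
  exact ⟨k, hk, rfl⟩

theorem eq_of_mem_lambdaStar {n m0 p : ℕ} (h1 : 1 ≤ m0) (hm0 : m0 ≤ n) {a a' : Fin n → ℕ∞}
    (ha : a ∈ LambdaStar n m0 p ⊤) (ha' : a' ∈ LambdaStar n m0 p ⊤)
    (h : ∀ j ≤ n, partialSum a j ≤ partialSum a' j) : a = a' := by
  obtain ⟨k, hp, hk, hkn, rfl⟩ := (mem_lambdaStar_iff hm0).1 ha
  obtain ⟨k', hp', hk', hkn', rfl⟩ := (mem_lambdaStar_iff hm0).1 ha'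
  have hsum : ∀ j ≤ n, starSum m0 p k j ≤ starSum m0 p k' j := fun j hj => by
    have := h j hj
    rw [partialSum_starSeq hp hj, partialSum_starSeq hp' hj] at this
    exact_mod_cast this
  suffices k = k' by rw [this]
  -- the partial sums before and after the place `m0` bound `k` from opposite sides
  have h2 := hsum (m0 - 1) (by omega)
  simp only [starSum, show m0 - 1 ≤ m0 by omega, if_true, show m0 - (m0 - 1) = 1 by omega] at h2
  rcases hm0.eq_or_lt with rfl | hlt
  · rw [hkn rfl, hkn' rfl]
  · have h3 := hsum (m0 + 1) hlt
    simp only [starSum, show ¬ m0 + 1 ≤ m0 by omega, if_false,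
      show m0 + 1 - m0 = 1 by omega] at h3
    omega

/-- Every nondecreasing sequence whose `m0`-th partial sum is `p` dominates one of the sequences
`starSeq`: the one with the same `m0`-th entry if `m0 < n`, and `(0, …, 0, p)` if `m0 = n`. -/
theorem exists_mem_lambdaStar_le {n m0 p : ℕ} (h1 : 1 ≤ m0) (hm0 : m0 ≤ n) {l : ℕ∞}
    {b : Fin n → ℕ∞} (hb : b ∈ LambdaContact n m0 p l) :
    ∃ a ∈ LambdaStar n m0 p ⊤, ∀ j ≤ n, partialSum a j ≤ partialSum b j := by
  obtain ⟨⟨hmono, -⟩, hsum⟩ := hb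
  have hle : ∀ i : Fin n, i.1 < m0 → b i ≤ p := fun i hi => hsum ▸ le_partialSum b hi
  obtain ⟨k, hkp, hkn, hbk, hkb⟩ : ∃ k : ℕ, k ≤ p ∧ (m0 = n → k = p) ∧
      (∀ i : Fin n, i.1 < m0 → b i ≤ k) ∧ ∀ i : Fin n, m0 ≤ i.1 → (k : ℕ∞) ≤ b i := by
    rcases hm0.eq_or_lt with rfl | hlt
    · exact ⟨p, le_rfl, fun _ => rfl, hle, fun i hi => absurd i.2 (not_lt.2 hi)⟩
    · have hlast := hle ⟨m0 - 1, by omega⟩ (by dsimp only; omega)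
      obtain ⟨k, hk⟩ := ENat.ne_top_iff_exists.1 (ne_top_of_le_ne_top (ENat.natCast_ne_top p) hlast)
      rw [← hk] at hlast
      refine ⟨k, by exact_mod_cast hlast, fun h => absurd h hlt.ne, fun i hi => ?_, fun i hi => ?_⟩
      · rw [hk]
        exact hmono (Fin.le_def.2 (by dsimp only; omega))
      · rw [hk]
        exact hmono (Fin.le_def.2 (by dsimp only; omega))
  have hbefore : ∀ e ≤ m0, (p : ℕ∞) ≤ partialSum b (m0 - e) + (k * e : ℕ) := by
    intro e
    induction e with
    | zero => intro _; simp [hsum]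
    | succ e ih =>
      intro he
      have h2 := ih (by omega)
      rw [show m0 - e = m0 - (e + 1) + 1 by omega, partialSum_succ b (by omega)] at h2
      refine h2.trans ?_
      rw [Nat.mul_succ, add_comm (k * e) k, Nat.cast_add, ← add_assoc]
      gcongr
      exact hbk _ (by dsimp only; omega)
  have hafter : ∀ e, m0 + e ≤ n → ((p + k * e : ℕ) : ℕ∞) ≤ partialSum b (m0 + e) := by
    intro e
    induction e with
    | zero => intro _; simp [hsum]
    | succ e ih =>
      intro he
      rw [← add_assoc, partialSum_succ b (by omega), Nat.mul_succ, ← add_assoc, Nat.cast_add]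
      exact add_le_add (ih (by omega)) (hkb _ (by dsimp only; omega))
  have hpk : p ≤ m0 * k := by
    have h2 := hbefore m0 le_rfl
    rw [Nat.sub_self, partialSum_zero, zero_add] at h2
    rw [mul_comm]
    exact_mod_cast h2
  refine ⟨starSeq n m0 p k, (mem_lambdaStar_iff hm0).2 ⟨k, hpk, hkp, hkn, rfl⟩, fun j hj => ?_⟩
  rw [partialSum_starSeq hpk hj, starSum]
  split_ifs with hjm
  · have h2 := hbefore (m0 - j) (by omega)
    rw [show m0 - (m0 - j) = j by omega] at h2
    generalize partialSum b j = x at h2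
    induction x using ENat.recTopCoe with
    | top => exact le_top
    | coe x =>
      norm_cast at h2 ⊢
      omega
  · have h2 := hafter (j - m0) (by omega)
    rwa [show m0 + (j - m0) = j by omega] at h2

/-! ### Irreducible components -/

theorem IsIrreducible.preimage_subtypeVal {X : Type*} [TopologicalSpace X] {Y S : Set X}
    (hS : IsIrreducible S) (hSY : S ⊆ Y) : IsIrreducible ((Subtype.val : Y → X) ⁻¹' S) := by
  obtain ⟨⟨x, hx⟩, hpre⟩ := hS
  refine ⟨⟨⟨x, hSY hx⟩, hx⟩, ?_⟩
  rintro _ _ ⟨U, hU, rfl⟩ ⟨V, hV, rfl⟩ ⟨y, hyS, hyU⟩ ⟨z, hzS, hzV⟩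
  obtain ⟨w, hwS, hwU, hwV⟩ := hpre U V hU hV ⟨y.1, hyS, hyU⟩ ⟨z.1, hzS, hzV⟩
  exact ⟨⟨w, hSY hwS⟩, hwS, hwU, hwV⟩

/-- If finitely many irreducible closed sets cover a space and none of them contains another
one, then they are the irreducible components. -/
theorem irreducibleComponents_eq_image {X ι : Type*} [TopologicalSpace X] {I : Set ι}
    (hI : I.Finite) {Z : ι → Set X} (hcl : ∀ i ∈ I, IsClosed (Z i))
    (hirr : ∀ i ∈ I, IsIrreducible (Z i)) (hcov : ∀ x, ∃ i ∈ I, x ∈ Z i)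
    (hanti : ∀ i ∈ I, ∀ j ∈ I, Z i ⊆ Z j → Z i = Z j) : irreducibleComponents X = Z '' I := by
  have key : ∀ W : Set X, IsIrreducible W → ∃ i ∈ I, W ⊆ Z i := by
    intro W hW
    have hfin := hI.image Z
    obtain ⟨z, hz, hWz⟩ := isIrreducible_iff_sUnion_isClosed.1 hW hfin.toFinset
      (by
        intro z hz
        obtain ⟨i, hi, rfl⟩ := hfin.mem_toFinset.1 hz
        exact hcl i hi)
      (by
        intro x _
        obtain ⟨i, hi, hx⟩ := hcov x
        exact ⟨Z i, by simpa using ⟨i, hi, rfl⟩, hx⟩)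
    obtain ⟨i, hi, rfl⟩ := hfin.mem_toFinset.1 hz
    exact ⟨i, hi, hWz⟩
  ext W
  constructor
  · intro hW
    obtain ⟨i, hi, hWi⟩ := key W hW.1
    exact ⟨i, hi, (hWi.antisymm (hW.2 (hirr i hi) hWi)).symm⟩
  · rintro ⟨i, hi, rfl⟩
    refine ⟨hirr i hi, fun W hW hiW => ?_⟩
    obtain ⟨j, hj, hWj⟩ := key W hW
    rw [hanti i hi j hj (hiW.trans hWj)]
    exact hWj

theorem theoremB (m m0 : ℕ) (hm0 : 1 ≤ m0) (hm0m : m0 ≤ m / 2) (p : ℕ) :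
    -- the contact locus is the disjoint union of congruence orbits, for jets and arcs
    (∀ l : ℕ∞, (p : ℕ∞) ≤ l →
      contactLocus (pfaffianIdeal m m0) p l =
          (⋃ a ∈ LambdaContact (m / 2) m0 p l, congruenceOrbit m l a) ∧
        (LambdaContact (m / 2) m0 p l).PairwiseDisjoint (congruenceOrbit m l)) ∧
    -- adjacency of orbits of arcs
    (∀ a ∈ LambdaSet (m / 2) ⊤, ∀ b ∈ LambdaSet (m / 2) ⊤,
      (congruenceOrbit m ⊤ b ⊆ closure (congruenceOrbit m ⊤ a) ↔
        ∀ k : ℕ, 1 ≤ k → k ≤ m / 2 → partialSum a k ≤ partialSum b k)) ∧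
    -- the irreducible components of the contact locus in the arc space; closures are taken
    -- inside the contact locus
    contactLocus (pfaffianIdeal m m0) p ⊤ =
      (⋃ a ∈ LambdaStar (m / 2) m0 p ⊤, closure (congruenceOrbit m ⊤ a)) ∩
        contactLocus (pfaffianIdeal m m0) p ⊤ ∧
    irreducibleComponents (contactLocus (pfaffianIdeal m m0) p ⊤) =
      (fun a => closure ((Subtype.val : contactLocus (pfaffianIdeal m m0) p ⊤ → SkewJet m ⊤) ⁻¹'
        congruenceOrbit m ⊤ a)) '' LambdaStar (m / 2) m0 p ⊤ ∧
    Set.InjOn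
      (fun a => closure ((Subtype.val : contactLocus (pfaffianIdeal m m0) p ⊤ → SkewJet m ⊤) ⁻¹'
        congruenceOrbit m ⊤ a)) (LambdaStar (m / 2) m0 p ⊤) := by

  have hsub : ∀ a ∈ LambdaContact (m / 2) m0 p ⊤,
      congruenceOrbit m ⊤ a ⊆ contactLocus (pfaffianIdeal m m0) p ⊤ := by
    intro a ha
    rw [contactLocus_eq_iUnion hm0m le_top]
    exact Set.subset_biUnion_of_mem ha
  have hcl : ∀ a ∈ LambdaContact (m / 2) m0 p ⊤,
      closure ((Subtype.val : contactLocus (pfaffianIdeal m m0) p ⊤ → SkewJet m ⊤) ⁻¹'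
        congruenceOrbit m ⊤ a) = Subtype.val ⁻¹' closure (congruenceOrbit m ⊤ a) := by
    intro a ha
    rw [Topology.IsInducing.subtypeVal.closure_eq_preimage_closure_image,
      Subtype.image_preimage_coe, Set.inter_eq_right.2 (hsub a ha)]
  have hle : ∀ a ∈ LambdaContact (m / 2) m0 p ⊤, ∀ b ∈ LambdaContact (m / 2) m0 p ⊤,
      closure ((Subtype.val : contactLocus (pfaffianIdeal m m0) p ⊤ → SkewJet m ⊤) ⁻¹'
        congruenceOrbit m ⊤ b) ⊆ closure (Subtype.val ⁻¹' congruenceOrbit m ⊤ a) →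
      ∀ k ≤ m / 2, partialSum a k ≤ partialSum b k := by
    intro a ha b hb h
    refine (congruenceOrbit_subset_closure_iff ha.1.1 hb.1.1).1 fun x hx => ?_
    have h1 := h (subset_closure (show (⟨x, hsub b hb hx⟩ :
      contactLocus (pfaffianIdeal m m0) p ⊤) ∈ Subtype.val ⁻¹' congruenceOrbit m ⊤ b from hx))
    rwa [hcl a ha] at h1
  have hcov : ∀ x ∈ contactLocus (pfaffianIdeal m m0) p ⊤,
      ∃ a ∈ LambdaStar (m / 2) m0 p ⊤, x ∈ closure (congruenceOrbit m ⊤ a) := by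
    intro x hx
    rw [contactLocus_eq_iUnion hm0m le_top] at hx
    obtain ⟨b, hb, hxb⟩ := Set.mem_iUnion₂.1 hx
    obtain ⟨a, ha, hab⟩ := exists_mem_lambdaStar_le hm0 hm0m hb
    exact ⟨a, ha, congruenceOrbit_subset_closure_of_partialSum_le hb.1.1 hab hxb⟩
  refine ⟨fun l hl => ⟨contactLocus_eq_iUnion hm0m hl,
    (pairwiseDisjoint_congruenceOrbit m l).subset fun a ha => ha.1⟩, ?_, ?_, ?_, ?_⟩
  · intro a ha b hb
    rw [congruenceOrbit_subset_closure_iff ha.1 hb.1]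
    refine forall_congr' fun k => ⟨fun h _ => h, fun h hk => ?_⟩
    rcases Nat.eq_zero_or_pos k with rfl | hk0
    · rw [partialSum_zero, partialSum_zero]
    · exact h hk0 hk
  · refine (Set.inter_eq_right.2 fun x hx => ?_).symm
    exact Set.mem_iUnion₂.2 (by simpa using hcov x hx)
  · refine irreducibleComponents_eq_image (finite_lambdaStar hm0m p)
      (fun _ _ => isClosed_closure) ?_ ?_ ?_
    · intro a ha
      exact ((isIrreducible_congruenceOrbit m a).preimage_subtypeVal (hsub a ha.1)).closure
    · intro x
      obtain ⟨a, ha, hxa⟩ := hcov x.1 x.2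
      refine ⟨a, ha, ?_⟩
      rw [hcl a ha.1]
      exact hxa
    · intro a ha b hb hab
      rw [eq_of_mem_lambdaStar hm0 hm0m hb ha (hle b hb.1 a ha.1 hab)]
  · intro a ha b hb hab
    exact eq_of_mem_lambdaStar hm0 hm0m ha hb (hle a ha.1 b hb.1 hab.ge)
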